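/- **Setting.** Let $k\ge 2$, $M\ge1$, $T\ge1$ be integers and let $\mathcal X$ carry a $k$-ary hierarchical partition $(\mathcal P_{h,i})_{h\ge0,\,1\le i\le k^h}$: $\mathcal P_{0,1}=\mathcal X$, the cells of each depth are pairwise disjoint, $\mathcal P_{h,i}=\bigcup_{j=0}^{k-1}\mathcal P_{h+1,ki-j}$, and each cell has a fixed representative point $x_{h,i}\in\mathcal P_{h,i}$. Client $m\in\{1,\dots,M\}$ has a local objective $f_m$; if it pulls $x\in\mathcal X$ in a round, it receives a random reward in $[0,1]$ with mean $f_m(x)$, rewards of distinct clients or distinct rounds being independent. Put $f=\frac1M\sum_m f_m$ and $f^*=\sup_{\mathcal X}f$. **Assumptions.** There are $\nu_1>0$, $0<\rho<1$ and $\ell:\mathcal X^2\to[0,\infty)$ with $\ell(x,x)=0$ such that $\ell(x,y)\le\nu_1\rho^h$ whenever $x,y$ lie in a common cell of depth $h$, and $f^*-f(y)\le f^*-f(x)+\max\{f^*-f(x),\ell(x,y)\}$ for all $x,y\in\mathcal X$ (weak-Lipschitz local smoothness). Moreover $f$ has near-optimality dimension $d\ge0$ with constant $C>0$: for each $h\ge0$,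 at most $C\rho^{-dh}$ of the nodes $(h,i)$ of depth $h$ satisfy $f^*-f(x_{h,i})\le6\nu_1\rho^h$. **Algorithm (Fed-PNE)** with parameters $c\ge2$, $c_1\ge(2M)^{1/8}$, $\delta=1/M$. Put $\tau_h=\left\lceil \frac{c^2\log(c_1T/\delta)}{\nu_1^2}\rho^{-2h}\right\rceil$, $t_h=\lceil\tau_h/M\rceil$, $b_h=c\sqrt{\log(c_1T/\delta)/(Mt_h)}$. Start with $h=1$ and $\mathcal K$ the set of children of the root. In each phase: (i) while $|\mathcal K|\tau_h\le M$ or $\tau_h\le1$, replace $\mathcal K$ by the set of all children of its nodes and $h$ by $h+1$; (ii) every client pulls $x_{h,i}$ for the nodes $(h,i)\in\mathcal K$ in increasing order of $i$, $t_h$ times each; (iii) $\widehat\mu_{h,i}$ is the average over the clients of their mean rewards from node $(h,i)$ in this phase, and the nodes with $\widehat\mu_{h,i}+b_h+\nu_1\rho^h<\max_{(h,j)\in\mathcal K}\widehat\mu_{h,j}-b_h$ are eliminated; (iv) $\mathcal K$ becomes the set of children of the remaining nodes and $h$ becomes $h+1$. The run is stopped after $T$ rounds, possibly within a phase. If $x_{m,t}$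 is the point pulled by client $m$ in round $t$, the regret is $R(T)=\sum_{m=1}^M\sum_{t=1}^T\bigl(f^*-f(x_{m,t})\bigr)$. **Theorem.** $R(T)$ is integrable and $$\mathbb E[R(T)]\le C_1M^{1-\frac1{2\log_k\rho}}+C_2\,M^{\frac{d+1}{d+2}}T^{\frac{d+1}{d+2}}(\log MT)^{\frac1{d+2}},$$ where $$C_1=\frac{48k\nu_1}{\rho^2-\rho^3}\Bigl(\frac{\nu_1^2}{c^2}\Bigr)^{-\frac1{2\log_k\rho}}+1,\qquad C_2=2\left(\frac{24kCc^2\rho^{-(d+3)}(12\nu_1)^{d+1}}{\nu_1(\rho^{-(d+1)}-1)}\right)^{\frac1{d+2}}(1+\log c_1).$$ If $c_1=(2M)^{1/8}$, the factor $1+\log c_1$ in $C_2$ may be replaced by $5/4$, so that $C_1$ and $C_2$ depend on neither $M$ nor $T$. -/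

import Mathlib

open MeasureTheory ProbabilityTheory

noncomputable section

namespace FedPNE

/-- A `k`-ary hierarchical partition of `X`. The nodes of depth `h` are indexed by `i < k ^ h`
(indices start at `0`); the children of `(h, i)` are `(h + 1, k * i + j)`, `j < k`. Every node
`(h, i)` carries a representative point `rep h i`, the arm that is pulled when the node is. -/
structure HierarchicalPartition (X : Type*) (k : ℕ) where
  cell : ℕ → ℕ → Set X
  rep : ℕ → ℕ → X
  cell_zero : cell 0 0 = Set.univ
  cell_children : ∀ h i, i < k ^ h → cell h i = ⋃ j ∈ Finset.range k, cell (h + 1) (k * i + j)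
  cell_disjoint : ∀ h i j, i < k ^ h → j < k ^ h → i ≠ j → Disjoint (cell h i) (cell h j)
  rep_mem : ∀ h i, i < k ^ h → rep h i ∈ cell h i

/-- The global objective: the average of the local objectives. -/
def globalObjective {X : Type*} {M : ℕ} (floc : Fin M → X → ℝ) (x : X) : ℝ :=
  (∑ m, floc m x) / M

/-- The global optimum `f* = sup f`. -/
def optimum {X : Type*} (f : X → ℝ) : ℝ := ⨆ x, f x

/-- Local smoothness: `ℓ` is a dissimilarity function, cells of depth `h` have `ℓ`-diameter at most
`ν₁ ρ ^ h`, and `f` is weakly Lipschitz with respect to `ℓ`. -/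
structure LocalSmoothness {X : Type*} {k : ℕ} (P : HierarchicalPartition X k) (ℓ : X → X → ℝ)
    (f : X → ℝ) (ν₁ ρ : ℝ) : Prop where
  dissim_nonneg : ∀ x y, 0 ≤ ℓ x y
  dissim_self : ∀ x, ℓ x x = 0
  diam_le : ∀ h i, i < k ^ h → ∀ x ∈ P.cell h i, ∀ y ∈ P.cell h i, ℓ x y ≤ ν₁ * ρ ^ h
  weak_lipschitz : ∀ x y,
    optimum f - f y ≤ optimum f - f x + max (optimum f - f x) (ℓ x y)

open Classical in
/-- The nodes of depth `h` whose representative point is `ε`-optimal. -/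
def nearOptimalNodes {X : Type*} {k : ℕ} (P : HierarchicalPartition X k) (f : X → ℝ)
    (h : ℕ) (ε : ℝ) : Finset ℕ :=
  (Finset.range (k ^ h)).filter fun i => optimum f - f (P.rep h i) ≤ ε

/-- `f` has near-optimality dimension `d` with constant `C`: for every depth `h` there are at most
`C (ρ ^ h) ^ (-d)` nodes of depth `h` that are `6 ν₁ ρ ^ h`-optimal. -/
def NearOptimalityDimension {X : Type*} {k : ℕ} (P : HierarchicalPartition X k) (f : X → ℝ)
    (ν₁ ρ C d : ℝ) : Prop :=
  ∀ h : ℕ, ((nearOptimalNodes P f h (6 * ν₁ * ρ ^ h)).card : ℝ) ≤ C * (ρ ^ h) ^ (-d)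

/-- The reward model. `R m t x` is the random reward that client `m` receives if it pulls the arm
`x` in round `t` (rounds start at `0`). Rewards lie in `[0, 1]`, have mean `f_m(x)`, and the rewards
of distinct clients or distinct rounds are independent. -/
structure RewardModel {X Ω : Type*} [MeasurableSpace Ω] (μ : Measure Ω) {M : ℕ}
    (floc : Fin M → X → ℝ) (R : Fin M → ℕ → X → Ω → ℝ) : Prop where
  measurable : ∀ m t x, Measurable (R m t x)
  mem_Icc : ∀ m t x, ∀ᵐ ω ∂μ, R m t x ω ∈ Set.Icc (0 : ℝ) 1
  mean : ∀ m t x, ∫ ω, R m t x ω ∂μ = floc m x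
  indep : iIndepFun (fun (q : Fin M × ℕ) (ω : Ω) (x : X) => R q.1 q.2 x ω) μ

/-- The parameters of the algorithm: arity `k`, number `M` of clients, horizon `T`, smoothness
parameters `ν₁`, `ρ`, confidence parameters `c`, `c₁`, `δ`. -/
structure Params where
  k : ℕ
  M : ℕ
  T : ℕ
  ν₁ : ℝ
  ρ : ℝ
  c : ℝ
  c₁ : ℝ
  δ : ℝ

/-- `log (c₁ T / δ)`. -/
def logTerm (a : Params) : ℝ := Real.log (a.c₁ * a.T / a.δ)

/-- The threshold `τ_h = ⌈c² log (c₁ T / δ) / ν₁² · ρ ^ (-2h)⌉`. -/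
def threshold (a : Params) (h : ℕ) : ℕ :=
  ⌈a.c ^ 2 * logTerm a / a.ν₁ ^ 2 * (a.ρ ^ (2 * h))⁻¹⌉₊

/-- The number `⌈τ_h / M⌉` of pulls of a node of depth `h` by each client. -/
def pulls (a : Params) (h : ℕ) : ℕ := ⌈(threshold a h : ℝ) / a.M⌉₊

/-- The confidence width `c √(log (c₁ T / δ) / (M ⌈τ_h / M⌉))` of a node of depth `h`. -/
def confWidth (a : Params) (h : ℕ) : ℝ :=
  a.c * Real.sqrt (logTerm a / ((a.M * pulls a h : ℕ) : ℝ))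

/-- All the children of the nodes in `K`. -/
def children (k : ℕ) (K : Finset ℕ) : Finset ℕ :=
  K.biUnion fun i => (Finset.range k).image fun j => k * i + j

/-- A phase: its first round, the depth of its nodes, and the indices of its nodes. -/
structure Phase where
  start : ℕ
  depth : ℕ
  nodes : Finset ℕ

/-- The number of rounds of a phase. -/
def Phase.length (a : Params) (p : Phase) : ℕ := p.nodes.card * pulls a p.depth

/-- The guard of the expansion loop. -/
def MustExpand (a : Params) (h : ℕ) (K : Finset ℕ) : Prop :=
  K.card * threshold a h ≤ a.M ∨ threshold a h ≤ 1

/-- The number of passes through the loop that replaces `K` by its children and increases `h`, for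
as long as the guard holds. -/
def expansionSteps (a : Params) (h : ℕ) (K : Finset ℕ) : ℕ :=
  sInf {j : ℕ | ¬ MustExpand a (h + j) ((children a.k)^[j] K)}

/-- The phase that starts in round `s` once the expansion loop has been run from `(h, K)`. -/
def openPhase (a : Params) (s h : ℕ) (K : Finset ℕ) : Phase where
  start := s
  depth := h + expansionSteps a h K
  nodes := (children a.k)^[expansionSteps a h K] K

/-- In a phase every client pulls the nodes one after the other, in increasing order, each of them
`pulls a depth` times in a row. This is the node pulled in round `t` of the phase. -/
def Phase.nodeAt (a : Params) (p : Phase) (t : ℕ) : ℕ :=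
  (p.nodes.sort (· ≤ ·)).getD ((t - p.start) / pulls a p.depth) 0

section Run

variable {X : Type*} (a : Params) (P : HierarchicalPartition X a.k) (r : Fin a.M → ℕ → X → ℝ)

/-- The mean of the rewards that client `m` received from node `i` in phase `p`, when `r` is the
realization of the rewards. -/
def localMean (p : Phase) (m : Fin a.M) (i : ℕ) : ℝ :=
  (∑ t ∈ (Finset.Ico p.start (p.start + p.length a)).filter (fun t => p.nodeAt a t = i),
    r m t (P.rep p.depth i)) / pulls a p.depth

/-- The server's estimate for node `i` in phase `p`. -/
def globalMean (p : Phase) (i : ℕ) : ℝ := (∑ m, localMean a P r p m i) / a.M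

open Classical in
/-- The nodes eliminated at the end of phase `p`; `j` is a maximizer of the server's estimates. -/
def eliminated (p : Phase) : Finset ℕ :=
  p.nodes.filter fun i => ∃ j ∈ p.nodes,
    (∀ j' ∈ p.nodes, globalMean a P r p j' ≤ globalMean a P r p j) ∧
    globalMean a P r p i + confWidth a p.depth + a.ν₁ * a.ρ ^ p.depth
      < globalMean a P r p j - confWidth a p.depth

/-- The successive phases of Fed-PNE. The first one is opened with the children of the root, each
later one with the children of the nodes that were not eliminated in the phase before. -/
def phase : ℕ → Phase
  | 0 => openPhase a 0 1 (children a.k {0})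
  | n + 1 =>
    let p := phase n
    openPhase a (p.start + p.length a) (p.depth + 1)
      (children a.k (p.nodes \ eliminated a P r p))

/-- The phase to which round `t` belongs. -/
def currentPhase (t : ℕ) : Phase :=
  phase a P r (sInf {n : ℕ | t < (phase a P r n).start + (phase a P r n).length a})

/-- The arm pulled by client `m` in round `t`; the server gives the same schedule to all clients. -/
def arm (_m : Fin a.M) (t : ℕ) : X :=
  P.rep (currentPhase a P r t).depth ((currentPhase a P r t).nodeAt a t)

/-- The cumulative regret of the `M` clients over the rounds `0, …, T - 1`. -/
def regret (f : X → ℝ) : ℝ :=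
  ∑ m : Fin a.M, ∑ t ∈ Finset.range a.T, (optimum f - f (arm a P r m t))

end Run

/-- The constant `C₁`. -/
def constC₁ (k : ℕ) (ν₁ ρ c : ℝ) : ℝ :=
  48 * k * ν₁ / (ρ ^ 2 - ρ ^ 3) * (ν₁ ^ 2 / c ^ 2) ^ (-(1 / (2 * Real.logb k ρ))) + 1

/-- The constant `C₂` up to the factor that depends on `c₁`. -/
def constC₂ (k : ℕ) (ν₁ ρ c C d : ℝ) : ℝ :=
  2 * (24 * k * C * c ^ 2 * ρ ^ (-(d + 3)) * (12 * ν₁) ^ (d + 1)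
    / (ν₁ * (ρ ^ (-(d + 1)) - 1))) ^ (1 / (d + 2))

/-- `M ^ ((d+1)/(d+2)) T ^ ((d+1)/(d+2)) (log (M T)) ^ (1/(d+2))`. -/
def regretRate (M T : ℕ) (d : ℝ) : ℝ :=
  (M : ℝ) ^ ((d + 1) / (d + 2)) * (T : ℝ) ^ ((d + 1) / (d + 2))
    * Real.log ((M : ℝ) * T) ^ (1 / (d + 2))

end FedPNE

end


/-!
The nodes of a phase depend only on the rewards of earlier rounds, so given the phase the rewards
collected in it are still independent and Hoeffding's inequality applies. A union bound over the
nodes of all phases shows that, up to an event of probability at most `1 / (M T)` (which adds at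
most `1` to the expected regret), every estimate is within the confidence width
`b_h ≤ ν₁ ρ ^ h` of its mean.

Outside that event a node on whose cell `f` comes arbitrarily close to `f*` is never eliminated, and
a node of depth `g` that survives its phase is `6 ν₁ ρ ^ g`-optimal. So there are at most
`C ρ ^ (-d g)` of those, and each pull of the phase opened from them costs at most `12 ν₁ ρ ^ g`. A
phase for which the expansion loop is entered, or whose depth `h` has `τ_h ≤ M`, takes at most a
constant times `M k ^ h` pulls for some `h` with `ρ ^ (-2h) ≤ M ν₁² / c²`; since `∑ ρ ^ g`
converges, these phases give the `C₁` term. The cost of any other phase is of order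
`ρ ^ (-(d+1) g)`; these costs are summed up to a depth `J`, while all deeper pulls together cost at
most `12 ν₁ ρ ^ J M T`, and balancing the two in `J` gives the `C₂` term.
-/

namespace FedPNE

/-! ### Sums and powers -/

section Sums

variable {ι : Type*} {g : ι → ℕ}

theorem sum_pow_le_inv_one_sub (hg : g.Injective) {ρ : ℝ} (hρ₀ : 0 ≤ ρ) (hρ₁ : ρ < 1)
    (A : Finset ι) : ∑ n ∈ A, ρ ^ g n ≤ (1 - ρ)⁻¹ := by
  classical
  rw [← Finset.sum_image (f := fun j => ρ ^ j) hg.injOn, ← tsum_geometric_of_lt_one hρ₀ hρ₁]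
  exact (summable_geometric_of_lt_one hρ₀ hρ₁).sum_le_tsum _ fun j _ => pow_nonneg hρ₀ j

theorem sum_ite_lt_pow_le_sum_range (hg : g.Injective) {q : ℝ} (hq : 0 ≤ q) (A : Finset ι)
    (J : ℕ) : ∑ n ∈ A, (if g n < J then q ^ g n else 0) ≤ ∑ j ∈ Finset.range J, q ^ j := by
  classical
  rw [← Finset.sum_filter, ← Finset.sum_image (f := fun j => q ^ j) hg.injOn]
  refine Finset.sum_le_sum_of_subset_of_nonneg ?_ fun j _ _ => pow_nonneg hq j
  intro j hj
  obtain ⟨n, hn, rfl⟩ := Finset.mem_image.1 hj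
  exact Finset.mem_range.2 (Finset.mem_filter.1 hn).2

end Sums

theorem geom_sum_le_pow_div {q : ℝ} (hq : 1 < q) (n : ℕ) :
    ∑ j ∈ Finset.range n, q ^ j ≤ q ^ n / (q - 1) := by
  rw [geom_sum_eq hq.ne']
  gcongr
  linarith

theorem rpow_neg_pow_eq {ρ : ℝ} (hρ : 0 ≤ ρ) (s : ℝ) (n : ℕ) :
    (ρ ^ (-s)) ^ n = (ρ ^ n) ^ (-s) := by
  rw [← Real.rpow_natCast, ← Real.rpow_mul hρ, mul_comm, Real.rpow_natCast_mul hρ]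

theorem rpow_mul_rpow_eq_of_balanced {d E W N y : ℝ} (hd : 0 ≤ d) (hW : 0 < W) (hN : 0 < N)
    (hy : 0 < y) (hbal : E = W * N * y ^ (d + 2)) :
    (E * W ^ (d + 1)) ^ (1 / (d + 2)) * N ^ ((d + 1) / (d + 2)) = W * N * y := by
  have hd2 : d + 2 ≠ 0 := by linarith
  have hE : 0 < E := by rw [hbal]; positivity
  have hpow : E * W ^ (d + 1) * N ^ (d + 1) = (W * N * y) ^ (d + 2) := by
    rw [hbal, Real.mul_rpow (by positivity) hy.le, show d + 2 = (d + 1) + 1 by ring,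
      Real.rpow_add_one (by positivity : W * N ≠ 0), Real.mul_rpow hW.le hN.le]
    ring
  have hN_pow : N ^ ((d + 1) / (d + 2)) = (N ^ (d + 1)) ^ (1 / (d + 2)) := by
    rw [← Real.rpow_mul hN.le, mul_one_div]
  rw [hN_pow, ← Real.mul_rpow (by positivity) (by positivity), hpow,
    ← Real.rpow_mul (by positivity), mul_one_div_cancel hd2, Real.rpow_one]

theorem mul_geom_sum_le_of_balanced {ρ d D K y : ℝ} (hρ₀ : 0 < ρ) (hρ₁ : ρ < 1) (hd : 0 ≤ d)
    (hD : 0 ≤ D) (hy : 0 < y)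
    (hbal : D * ρ ^ (-(d + 1)) / (ρ ^ (-(d + 1)) - 1) = K * y ^ (d + 2)) {n : ℕ}
    (hn : y ≤ ρ ^ n) :
    D * ∑ j ∈ Finset.range (n + 1), (ρ ^ (-(d + 1))) ^ j ≤ K * y := by
  set q := ρ ^ (-(d + 1)) with hq
  have hq1 : 1 < q := Real.one_lt_rpow_of_pos_of_lt_one_of_neg hρ₀ hρ₁ (by linarith)
  have hqn : q ^ n ≤ y ^ (-(d + 1)) := by
    rw [hq, rpow_neg_pow_eq hρ₀.le]
    exact Real.rpow_le_rpow_of_nonpos hy hn (by linarith)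
  have hE : 0 ≤ D * q / (q - 1) := div_nonneg (by positivity) (by linarith)
  calc D * ∑ j ∈ Finset.range (n + 1), q ^ j ≤ D * (q ^ (n + 1) / (q - 1)) :=
        mul_le_mul_of_nonneg_left (geom_sum_le_pow_div hq1 _) hD
    _ = D * q / (q - 1) * q ^ n := by ring
    _ ≤ D * q / (q - 1) * y ^ (-(d + 1)) := mul_le_mul_of_nonneg_left hqn hE
    _ = K * y := by
        rw [hbal, mul_assoc, ← Real.rpow_add hy, show d + 2 + -(d + 1) = 1 by ring, Real.rpow_one]

/-- The two terms on the left balance at the depth where `ρ ^ J` reaches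
`y = (D ρ ^ (-(d+1)) / ((ρ ^ (-(d+1)) - 1) W N)) ^ (1/(d+2))`, and there each of them is at most
`W N y`. -/
theorem exists_depth_tradeoff {ρ d D W N : ℝ} (hρ₀ : 0 < ρ) (hρ₁ : ρ < 1) (hd : 0 ≤ d)
    (hD : 0 < D) (hW : 0 < W) (hN : 0 < N) :
    ∃ J : ℕ, D * ∑ j ∈ Finset.range J, (ρ ^ (-(d + 1))) ^ j + W * ρ ^ J * N ≤
      2 * ((D * ρ ^ (-(d + 1)) * W ^ (d + 1) / (ρ ^ (-(d + 1)) - 1)) ^ (1 / (d + 2)) *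
        N ^ ((d + 1) / (d + 2))) := by
  have hq : 0 < ρ ^ (-(d + 1)) - 1 :=
    sub_pos.2 (Real.one_lt_rpow_of_pos_of_lt_one_of_neg hρ₀ hρ₁ (by linarith))
  obtain ⟨E, hE⟩ : ∃ E, E = D * ρ ^ (-(d + 1)) / (ρ ^ (-(d + 1)) - 1) := ⟨_, rfl⟩
  have hE0 : 0 < E := by rw [hE]; positivity
  obtain ⟨y, hy, hbal⟩ : ∃ y, 0 < y ∧ E = W * N * y ^ (d + 2) := by
    refine ⟨(E / (W * N)) ^ (1 / (d + 2)), by positivity, ?_⟩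
    rw [← Real.rpow_mul (by positivity), one_div_mul_cancel (by linarith), Real.rpow_one]
    field_simp
  rw [show D * ρ ^ (-(d + 1)) * W ^ (d + 1) / (ρ ^ (-(d + 1)) - 1) = E * W ^ (d + 1) by
    rw [hE]; ring, rpow_mul_rpow_eq_of_balanced hd hW hN hy hbal]
  have hWN : 0 < W * N := mul_pos hW hN
  rcases le_total 1 y with hy1 | hy1
  · refine ⟨0, ?_⟩
    simp only [Finset.range_zero, Finset.sum_empty, mul_zero, pow_zero, mul_one, zero_add]
    linarith [mul_le_mul_of_nonneg_left hy1 hWN.le]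
  · obtain ⟨n, hlt, hle⟩ := exists_nat_pow_near_of_lt_one hy hy1 hρ₀ hρ₁
    refine ⟨n + 1, ?_⟩
    have hfirst := mul_geom_sum_le_of_balanced hρ₀ hρ₁ hd hD.le hy (hE.symm.trans hbal) hle
    have hsecond := mul_le_mul_of_nonneg_left hlt.le hWN.le
    linarith

theorem neg_one_div_two_mul_logb_nonneg {b ρ : ℝ} (hb : 1 < b) (hρ₀ : 0 < ρ) (hρ₁ : ρ < 1) :
    0 ≤ -(1 / (2 * Real.logb b ρ)) := by
  have hlog := Real.logb_neg hb hρ₀ hρ₁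
  exact neg_nonneg.2 (div_nonpos_of_nonneg_of_nonpos zero_le_one (by linarith))

theorem pow_le_rpow_of_inv_pow_le {b ρ y : ℝ} (hb : 1 < b) (hρ₀ : 0 < ρ) (hρ₁ : ρ < 1) {h : ℕ}
    (hy : (ρ ^ (2 * h))⁻¹ ≤ y) : b ^ h ≤ y ^ (-(1 / (2 * Real.logb b ρ))) := by
  have hb0 : 0 < b := by linarith
  have hlog : Real.logb b ρ < 0 := Real.logb_neg hb hρ₀ hρ₁
  have hbase : (ρ ^ (2 * h))⁻¹ = b ^ (-(2 * h * Real.logb b ρ)) := by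
    conv_lhs => rw [← Real.rpow_logb hb0 hb.ne' hρ₀]
    rw [← Real.rpow_natCast, ← Real.rpow_mul hb0.le, ← Real.rpow_neg hb0.le]
    push_cast
    ring_nf
  calc b ^ h = ((ρ ^ (2 * h))⁻¹) ^ (-(1 / (2 * Real.logb b ρ))) := by
        rw [hbase, ← Real.rpow_mul hb0.le, ← Real.rpow_natCast]
        congr 1
        field_simp [hlog.ne]
    _ ≤ y ^ (-(1 / (2 * Real.logb b ρ))) :=
        Real.rpow_le_rpow (by positivity) hy (neg_one_div_two_mul_logb_nonneg hb hρ₀ hρ₁)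

theorem rpow_one_div_add_two_le_mul {x y K d : ℝ} (hx : 0 ≤ x) (hy : 0 ≤ y) (hK : 1 ≤ K)
    (hxy : x ≤ K ^ 2 * y) (hd : 0 ≤ d) : x ^ (1 / (d + 2)) ≤ K * y ^ (1 / (d + 2)) := by
  have hd2 : d + 2 ≠ 0 := by linarith
  have hK0 : 0 ≤ K := by linarith
  calc x ^ (1 / (d + 2)) ≤ (K ^ (d + 2) * y) ^ (1 / (d + 2)) := by
        refine Real.rpow_le_rpow hx (hxy.trans ?_) (by positivity)
        rw [← Real.rpow_two]
        gcongr
        linarith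
    _ = K * y ^ (1 / (d + 2)) := by
        rw [Real.mul_rpow (by positivity) hy, ← Real.rpow_mul hK0, mul_one_div_cancel hd2,
          Real.rpow_one]

/-! ### Concentration of independent bounded variables -/

section Probability

variable {Ω : Type*} [MeasurableSpace Ω] {μ : Measure Ω}

section Hoeffding

variable {ι : Type*} {X : ι → Ω → ℝ}

theorem exp_hoeffding_eq (ε : ℝ) (n : ℕ) :
    Real.exp (-ε ^ 2 / (2 * ((n • ((‖(1 : ℝ) - 0‖₊ / 2) ^ 2) : NNReal) : ℝ)))
      = Real.exp (-2 * ε ^ 2 / n) := by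
  rcases n.eq_zero_or_pos with rfl | hn
  · simp
  · have : (0 : ℝ) < n := by exact_mod_cast hn
    congr 1
    rw [sub_zero, nnnorm_one]
    push_cast [nsmul_eq_mul]
    field_simp

theorem measureReal_abs_sum_sub_integral_ge_le [IsProbabilityMeasure μ] (hX : iIndepFun X μ)
    {s : Finset ι} (hmeas : ∀ i ∈ s, AEMeasurable (X i) μ)
    (hmem : ∀ i ∈ s, ∀ᵐ ω ∂μ, X i ω ∈ Set.Icc (0 : ℝ) 1) {ε : ℝ} (hε : 0 ≤ ε) :
    μ.real {ω | ε ≤ |∑ i ∈ s, (X i ω - μ[X i])|} ≤ 2 * Real.exp (-2 * ε ^ 2 / s.card) := by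
  have hsub : ∀ i ∈ s, HasSubgaussianMGF (fun ω => X i ω - μ[X i])
      ((‖(1 : ℝ) - 0‖₊ / 2) ^ 2) μ := fun i hi =>
    hasSubgaussianMGF_of_mem_Icc (hmeas i hi) (hmem i hi)
  have hind : iIndepFun (fun i ω => X i ω - μ[X i]) μ :=
    hX.comp (fun i x => x - ∫ ω, X i ω ∂μ) fun i => measurable_id.sub_const _
  have hindneg : iIndepFun (fun i => -fun ω => X i ω - μ[X i]) μ :=
    hind.comp (fun _ x => -x) fun _ => measurable_neg
  have hupper := HasSubgaussianMGF.measure_sum_ge_le_of_iIndepFun hind hsub hε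
  have hlower := HasSubgaussianMGF.measure_sum_ge_le_of_iIndepFun hindneg
    (fun i hi => (hsub i hi).neg) hε
  rw [Finset.sum_const, exp_hoeffding_eq] at hupper hlower
  calc μ.real {ω | ε ≤ |∑ i ∈ s, (X i ω - μ[X i])|}
      ≤ μ.real ({ω | ε ≤ ∑ i ∈ s, (X i ω - μ[X i])} ∪
          {ω | ε ≤ ∑ i ∈ s, (-fun ω => X i ω - μ[X i]) ω}) := by
        refine measureReal_mono fun ω hω => ?_
        simpa only [Set.mem_union, Set.mem_ofPred_eq, Pi.neg_apply, Finset.sum_neg_distrib]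
          using le_abs.1 hω
    _ ≤ Real.exp (-2 * ε ^ 2 / s.card) + Real.exp (-2 * ε ^ 2 / s.card) :=
        (measureReal_union_le _ _).trans (add_le_add hupper hlower)
    _ = 2 * Real.exp (-2 * ε ^ 2 / s.card) := by ring

end Hoeffding

theorem measure_setOf_mem_apply_le [IsProbabilityMeasure μ] {β : Type*} [Countable β] {Z : Ω → β}
    (hZ : ∀ z, MeasurableSet (Z ⁻¹' {z})) {A : β → Set Ω} {ε : ENNReal}
    (hA : ∀ z, μ (Z ⁻¹' {z} ∩ A z) ≤ μ (Z ⁻¹' {z}) * ε) : μ {ω | ω ∈ A (Z ω)} ≤ ε := by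
  have hdisj : Pairwise (Function.onFun Disjoint fun z => Z ⁻¹' {z}) := fun _ _ h =>
    (Set.disjoint_singleton.2 h).preimage Z
  calc μ {ω | ω ∈ A (Z ω)} ≤ μ (⋃ z, Z ⁻¹' {z} ∩ A z) :=
        measure_mono fun ω hω => Set.mem_iUnion.2 ⟨Z ω, rfl, hω⟩
    _ ≤ ∑' z, μ (Z ⁻¹' {z}) * ε := (measure_iUnion_le _).trans (ENNReal.tsum_le_tsum hA)
    _ = μ (⋃ z, Z ⁻¹' {z}) * ε := by rw [ENNReal.tsum_mul_right, measure_iUnion hdisj hZ]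
    _ ≤ ε := mul_le_of_le_one_left zero_le prob_le_one

theorem integral_le_add_mul_measureReal [IsProbabilityMeasure μ] {Y : Ω → ℝ}
    (hY : Integrable Y μ) {B G : ℝ} (hG : 0 ≤ G) (hB : ∀ ω, Y ω ≤ B) {E : Set Ω}
    (hE : MeasurableSet E) (hYG : ∀ ω ∉ E, Y ω ≤ G) : ∫ ω, Y ω ∂μ ≤ G + B * μ.real E := by
  have hbound : ∀ ω, Y ω ≤ G + E.indicator (fun _ => B) ω := fun ω => by
    by_cases hω : ω ∈ E
    · rw [Set.indicator_of_mem hω]; linarith [hB ω]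
    · rw [Set.indicator_of_notMem hω, add_zero]; exact hYG ω hω
  have hind : Integrable (E.indicator fun _ => B) μ := (integrable_const B).indicator hE
  calc ∫ ω, Y ω ∂μ ≤ ∫ ω, (G + E.indicator (fun _ => B) ω) ∂μ :=
        integral_mono hY ((integrable_const G).add hind) hbound
    _ = G + B * μ.real E := by
        rw [integral_add (integrable_const G) hind, integral_indicator_const B hE]
        simp [mul_comm]

end Probability

/-! ### Thresholds, numbers of pulls and confidence widths -/

/-- The conditions on the parameters under which the algorithm can be analysed on a fixed
realization of the rewards. -/
structure Params.Admissible (a : Params) : Prop where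
  two_le_k : 2 ≤ a.k
  one_le_M : 1 ≤ a.M
  ν₁_pos : 0 < a.ν₁
  ρ_pos : 0 < a.ρ
  ρ_lt_one : a.ρ < 1
  c_pos : 0 < a.c
  logTerm_pos : 0 < logTerm a

/-- The conditions `c ≥ 2`, `c₁ ≥ (2M) ^ (1/8)` and `δ = 1/M`, which make the estimates accurate
with high probability. -/
structure Params.Calibrated (a : Params) : Prop where
  one_le_M : 1 ≤ a.M
  one_le_T : 1 ≤ a.T
  two_le_c : 2 ≤ a.c
  rpow_le_c₁ : (2 * (a.M : ℝ)) ^ (1 / 8 : ℝ) ≤ a.c₁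
  δ_eq : a.δ = 1 / (a.M : ℝ)

/-- The real number `c² log (c₁ T / δ) / ν₁² · ρ ^ (-2h)` whose ceiling is the threshold `τ_h`. -/
noncomputable def level (a : Params) (h : ℕ) : ℝ :=
  a.c ^ 2 * logTerm a / a.ν₁ ^ 2 * (a.ρ ^ (2 * h))⁻¹

/-- Hoeffding's bound for the probability that the estimate of one node is off by more than the
confidence width of the node. -/
noncomputable def failureProb (a : Params) : ℝ := 2 * Real.exp (-2 * (a.c ^ 2 * logTerm a))

section Calibrated

variable {a : Params} (ha : a.Calibrated)
include ha

theorem Params.Calibrated.c_pos : 0 < a.c := two_pos.trans_le ha.two_le_c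

theorem Params.Calibrated.two_mul_M_le_pow : 2 * (a.M : ℝ) ≤ a.c₁ ^ 8 := by
  calc 2 * (a.M : ℝ) = ((2 * (a.M : ℝ)) ^ (1 / 8 : ℝ)) ^ 8 := by
        rw [← Real.rpow_natCast, ← Real.rpow_mul (by positivity)]
        norm_num
    _ ≤ a.c₁ ^ 8 := by
        gcongr
        exact ha.rpow_le_c₁

theorem Params.Calibrated.one_lt_c₁ : 1 < a.c₁ := by
  have hM : (1 : ℝ) ≤ a.M := by exact_mod_cast ha.one_le_M
  exact (Real.one_lt_rpow (by linarith) (by norm_num)).trans_le ha.rpow_le_c₁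

theorem Params.Calibrated.one_le_M_mul_T : (1 : ℝ) ≤ a.M * a.T := by
  exact_mod_cast Nat.mul_pos ha.one_le_M ha.one_le_T

theorem Params.Calibrated.logTerm_eq :
    logTerm a = Real.log a.c₁ + Real.log (a.M * a.T) := by
  rw [logTerm, ha.δ_eq, div_div_eq_mul_div, div_one, mul_assoc, mul_comm (a.T : ℝ),
    Real.log_mul (one_pos.trans ha.one_lt_c₁).ne' (one_pos.trans_le ha.one_le_M_mul_T).ne']

theorem Params.Calibrated.log_le_logTerm : Real.log (a.M * a.T) ≤ logTerm a := by
  rw [ha.logTerm_eq]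
  linarith [Real.log_pos ha.one_lt_c₁]

theorem Params.Calibrated.logTerm_pos : 0 < logTerm a := by
  rw [ha.logTerm_eq]
  linarith [Real.log_pos ha.one_lt_c₁, Real.log_nonneg ha.one_le_M_mul_T]

theorem Params.Calibrated.two_mul_le_exp_logTerm_pow :
    2 * ((a.M : ℝ) * a.T ^ 3) ≤ Real.exp (logTerm a) ^ 8 := by
  have hT : (1 : ℝ) ≤ a.T := by exact_mod_cast ha.one_le_T
  have hM : (1 : ℝ) ≤ a.M := by exact_mod_cast ha.one_le_M
  have hexp : Real.exp (logTerm a) = a.c₁ * (a.M * a.T) := by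
    rw [ha.logTerm_eq, Real.exp_add, Real.exp_log (one_pos.trans ha.one_lt_c₁),
      Real.exp_log (by positivity)]
  calc 2 * ((a.M : ℝ) * a.T ^ 3) = 2 * a.M * (1 * a.T ^ 3) := by ring
    _ ≤ a.c₁ ^ 8 * (a.M ^ 8 * a.T ^ 8) := by
        gcongr
        · exact ha.two_mul_M_le_pow
        · exact one_le_pow₀ hM
        · norm_num
    _ = Real.exp (logTerm a) ^ 8 := by rw [hexp]; ring

theorem Params.Calibrated.mul_failureProb_le_one :
    (a.M : ℝ) * a.T ^ 3 * failureProb a ≤ 1 := by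
  have hc : (2 : ℝ) ^ 2 ≤ a.c ^ 2 := pow_le_pow_left₀ zero_le_two ha.two_le_c 2
  have hexp : Real.exp (-2 * (a.c ^ 2 * logTerm a)) ≤ (Real.exp (logTerm a) ^ 8)⁻¹ := by
    rw [← Real.exp_nat_mul, ← Real.exp_neg, Real.exp_le_exp]
    push_cast
    linarith [mul_le_mul_of_nonneg_right hc ha.logTerm_pos.le]
  calc (a.M : ℝ) * a.T ^ 3 * failureProb a
      ≤ a.M * a.T ^ 3 * (2 * (Real.exp (logTerm a) ^ 8)⁻¹) := by
        rw [failureProb]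
        gcongr
    _ = 2 * (a.M * a.T ^ 3) / Real.exp (logTerm a) ^ 8 := by ring
    _ ≤ 1 := (div_le_one (by positivity)).2 ha.two_mul_le_exp_logTerm_pow

end Calibrated

theorem level_succ (a : Params) (h : ℕ) : level a (h + 1) = (a.ρ ^ 2)⁻¹ * level a h := by
  rw [level, level, mul_add_one, pow_add, mul_inv]
  ring

theorem level_le_threshold (a : Params) (h : ℕ) : level a h ≤ threshold a h := Nat.le_ceil _

section Admissible

variable {a : Params} (ha : a.Admissible)
include ha

theorem Params.Admissible.k_pos : 0 < a.k := two_pos.trans_le ha.two_le_k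

theorem Params.Admissible.M_pos : (0 : ℝ) < a.M := by exact_mod_cast ha.one_le_M

theorem level_pos (h : ℕ) : 0 < level a h := by
  have := ha.c_pos; have := ha.logTerm_pos; have := ha.ν₁_pos; have := ha.ρ_pos
  unfold level
  positivity

theorem threshold_pos (h : ℕ) : 0 < threshold a h := Nat.ceil_pos.2 (level_pos ha h)

theorem threshold_le_mul_pulls (h : ℕ) : threshold a h ≤ a.M * pulls a h := by
  have hceil : (threshold a h : ℝ) / a.M ≤ pulls a h := Nat.le_ceil _
  rw [div_le_iff₀' ha.M_pos] at hceil
  exact_mod_cast hceil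

theorem pulls_pos (h : ℕ) : 0 < pulls a h :=
  Nat.pos_of_mul_pos_left ((threshold_pos ha h).trans_le (threshold_le_mul_pulls ha h))

theorem mul_pulls_pos (h : ℕ) : (0 : ℝ) < (a.M * pulls a h : ℕ) := by
  exact_mod_cast Nat.mul_pos ha.one_le_M (pulls_pos ha h)

theorem level_le_mul_pulls (h : ℕ) : level a h ≤ (a.M * pulls a h : ℕ) :=
  (level_le_threshold a h).trans (by exact_mod_cast threshold_le_mul_pulls ha h)

theorem mul_pulls_le (h : ℕ) : (a.M : ℝ) * pulls a h ≤ level a h + a.M := by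
  have hthreshold : (threshold a h : ℝ) < level a h + 1 := Nat.ceil_lt_add_one (level_pos ha h).le
  have hpulls : (a.M : ℝ) * pulls a h < threshold a h + a.M := by
    have := Nat.ceil_lt_add_one (div_nonneg (Nat.cast_nonneg (threshold a h)) ha.M_pos.le)
    rwa [div_add_one ha.M_pos.ne', lt_div_iff₀' ha.M_pos] at this
  have hpulls_nat : a.M * pulls a h + 1 ≤ threshold a h + a.M := by exact_mod_cast hpulls
  have hpulls_real : (a.M : ℝ) * pulls a h + 1 ≤ threshold a h + a.M := by
    exact_mod_cast hpulls_nat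
  linarith

theorem confWidth_nonneg (h : ℕ) : 0 ≤ confWidth a h :=
  mul_nonneg ha.c_pos.le (Real.sqrt_nonneg _)

theorem mul_confWidth_sq (h : ℕ) :
    ((a.M * pulls a h : ℕ) : ℝ) * confWidth a h ^ 2 = a.c ^ 2 * logTerm a := by
  have hN := mul_pulls_pos ha h
  rw [confWidth, mul_pow, Real.sq_sqrt (div_nonneg ha.logTerm_pos.le hN.le)]
  field_simp

theorem confWidth_le (h : ℕ) : confWidth a h ≤ a.ν₁ * a.ρ ^ h := by
  have hν := ha.ν₁_pos; have hρ := ha.ρ_pos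
  have hlevel : level a h * (a.ν₁ * a.ρ ^ h) ^ 2 = a.c ^ 2 * logTerm a := by
    unfold level
    field_simp
    ring
  refine le_of_sq_le_sq (le_of_mul_le_mul_left ?_ (level_pos ha h)) (by positivity)
  rw [hlevel, ← mul_confWidth_sq ha h]
  exact mul_le_mul_of_nonneg_right (level_le_mul_pulls ha h) (sq_nonneg _)

end Admissible

/-! ### Children and the expansion loop -/

theorem mem_children {k : ℕ} {K : Finset ℕ} {i : ℕ} :
    i ∈ children k K ↔ ∃ i' ∈ K, ∃ j < k, k * i' + j = i := by
  simp only [children, Finset.mem_biUnion, Finset.mem_image, Finset.mem_range]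

theorem card_children (k : ℕ) (K : Finset ℕ) : (children k K).card = k * K.card := by
  rw [children, Finset.card_biUnion]
  · simp only [Finset.card_image_of_injective _ (add_right_injective _), Finset.card_range,
      Finset.sum_const, smul_eq_mul, mul_comm]
  · intro i _ i' _ hne
    rw [Function.onFun, Finset.disjoint_left]
    simp only [Finset.mem_image, Finset.mem_range]
    rintro _ ⟨u, hu, rfl⟩ ⟨v, hv, huv⟩
    have hk : 0 < k := by omega
    have hdiv := congrArg (· / k) huv
    simp only [Nat.mul_add_div hk, Nat.div_eq_of_lt hu, Nat.div_eq_of_lt hv, add_zero] at hdiv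
    exact hne hdiv.symm

theorem card_children_iterate (k : ℕ) (K : Finset ℕ) (j : ℕ) :
    ((children k)^[j] K).card = k ^ j * K.card := by
  induction j with
  | zero => simp
  | succ j ih => rw [Function.iterate_succ_apply', card_children, ih, pow_succ', mul_assoc]

theorem children_subset_range {k h : ℕ} {K : Finset ℕ} (hK : K ⊆ Finset.range (k ^ h)) :
    children k K ⊆ Finset.range (k ^ (h + 1)) := by
  intro i hi
  obtain ⟨i', hi', j, hj, rfl⟩ := mem_children.1 hi
  rw [Finset.mem_range, pow_succ']
  calc k * i' + j < k * (i' + 1) := by rw [mul_add_one]; omega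
    _ ≤ k * k ^ h := Nat.mul_le_mul_left _ (Finset.mem_range.1 (hK hi'))

theorem children_iterate_subset_range {k h : ℕ} {K : Finset ℕ} (hK : K ⊆ Finset.range (k ^ h))
    (j : ℕ) : (children k)^[j] K ⊆ Finset.range (k ^ (h + j)) := by
  induction j with
  | zero => exact hK
  | succ j ih => rw [Function.iterate_succ_apply', ← add_assoc]; exact children_subset_range ih

theorem children_iterate_nonempty {k : ℕ} (hk : 0 < k) {K : Finset ℕ} (hK : K.Nonempty) (j : ℕ) :
    ((children k)^[j] K).Nonempty := by
  rw [← Finset.card_pos, card_children_iterate]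
  exact Nat.mul_pos (Nat.pow_pos hk) hK.card_pos

theorem mustExpand_of_lt_expansionSteps {a : Params} {h j : ℕ} {K : Finset ℕ}
    (hj : j < expansionSteps a h K) : MustExpand a (h + j) ((children a.k)^[j] K) :=
  not_not.1 (Nat.notMem_of_lt_sInf hj)

/-! ### The rounds of a phase -/

section Rounds

variable {a : Params} {p : Phase}

theorem filter_nodeAt_eq_Ico (hq : 0 < pulls a p.depth) {n : ℕ}
    (hn : n < (p.nodes.sort (· ≤ ·)).length) :
    (Finset.Ico p.start (p.start + p.length a)).filter
        (fun t => p.nodeAt a t = (p.nodes.sort (· ≤ ·))[n])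
      = Finset.Ico (p.start + n * pulls a p.depth) (p.start + n * pulls a p.depth
          + pulls a p.depth) := by
  have hlen : (p.nodes.sort (· ≤ ·)).length = p.nodes.card := Finset.length_sort _
  have hnodup : (p.nodes.sort (· ≤ ·)).Nodup := Finset.sort_nodup _ _
  ext t
  rw [Finset.mem_filter]
  simp only [Finset.mem_Ico, Phase.nodeAt, Phase.length]
  constructor
  · rintro ⟨⟨hstart, hend⟩, hnode⟩
    have hlt : (t - p.start) / pulls a p.depth < (p.nodes.sort (· ≤ ·)).length := by
      rw [hlen, Nat.div_lt_iff_lt_mul hq]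
      omega
    rw [List.getD_eq_getElem _ _ hlt, hnodup.getElem_inj_iff, Nat.div_eq_iff hq] at hnode
    omega
  · rintro ⟨hstart, hend⟩
    have hdiv : (t - p.start) / pulls a p.depth = n := by
      rw [Nat.div_eq_iff hq]
      omega
    have hle : (n + 1) * pulls a p.depth ≤ p.nodes.card * pulls a p.depth :=
      Nat.mul_le_mul_right _ (hlen ▸ hn)
    rw [add_one_mul] at hle
    exact ⟨⟨by omega, by omega⟩, by rw [hdiv, List.getD_eq_getElem _ _ hn]⟩

theorem card_filter_nodeAt (hq : 0 < pulls a p.depth) {i : ℕ} (hi : i ∈ p.nodes) :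
    ((Finset.Ico p.start (p.start + p.length a)).filter (fun t => p.nodeAt a t = i)).card
      = pulls a p.depth := by
  obtain ⟨n, hn, rfl⟩ := List.getElem_of_mem ((Finset.mem_sort (· ≤ ·)).2 hi)
  rw [filter_nodeAt_eq_Ico hq hn, Nat.card_Ico, Nat.add_sub_cancel_left]

theorem nodeAt_mem (hq : 0 < pulls a p.depth) {t : ℕ} (hstart : p.start ≤ t)
    (hend : t < p.start + p.length a) : p.nodeAt a t ∈ p.nodes := by
  have hlt : (t - p.start) / pulls a p.depth < (p.nodes.sort (· ≤ ·)).length := by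
    rw [Finset.length_sort, Nat.div_lt_iff_lt_mul hq]
    unfold Phase.length at hend
    omega
  rw [Phase.nodeAt, List.getD_eq_getElem _ _ hlt]
  exact (Finset.mem_sort (· ≤ ·)).1 (List.getElem_mem hlt)

end Rounds

/-! ### The sequence of phases -/

section Run

variable {X : Type*} (a : Params) (P : HierarchicalPartition X a.k) (r : Fin a.M → ℕ → X → ℝ)

/-- The depth of the nodes from whose children phase `n` is opened. -/
noncomputable def baseDepth : ℕ → ℕ
  | 0 => 0
  | n + 1 => (phase a P r n).depth

/-- The nodes from whose children phase `n` is opened: the root, or the nodes that survive the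
preceding phase. -/
noncomputable def baseNodes : ℕ → Finset ℕ
  | 0 => {0}
  | n + 1 => (phase a P r n).nodes \ eliminated a P r (phase a P r n)

/-- The number of generations between the base nodes and the nodes of phase `n`: one, and one more
for each pass through the expansion loop. -/
noncomputable def generations (n : ℕ) : ℕ :=
  1 + expansionSteps a (baseDepth a P r n + 1) (children a.k (baseNodes a P r n))

/-- The index of the phase to which round `t` belongs. -/
noncomputable def phaseIndex (t : ℕ) : ℕ := sInf {n : ℕ | t < (phase a P r (n + 1)).start}

variable {a}

theorem phase_depth (n : ℕ) :
    (phase a P r n).depth = baseDepth a P r n + generations a P r n := by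
  rw [generations, ← add_assoc]
  cases n <;> rfl

theorem phase_nodes (n : ℕ) :
    (phase a P r n).nodes = (children a.k)^[generations a P r n] (baseNodes a P r n) := by
  rw [generations, add_comm, Function.iterate_succ_apply]
  cases n <;> rfl

theorem phase_start_succ (n : ℕ) :
    (phase a P r (n + 1)).start = (phase a P r n).start + (phase a P r n).length a := rfl

theorem arm_eq (m : Fin a.M) (t : ℕ) :
    arm a P r m t = P.rep (phase a P r (phaseIndex a P r t)).depth
      ((phase a P r (phaseIndex a P r t)).nodeAt a t) := rfl

theorem mustExpand_of_lt_generations {n j : ℕ} (hj : j + 1 < generations a P r n) :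
    MustExpand a (baseDepth a P r n + (j + 1))
      ((children a.k)^[j + 1] (baseNodes a P r n)) := by
  have hguard : MustExpand a (baseDepth a P r n + 1 + j)
      ((children a.k)^[j] (children a.k (baseNodes a P r n))) :=
    mustExpand_of_lt_expansionSteps (by unfold generations at hj; omega)
  rwa [add_assoc, add_comm 1 j] at hguard

theorem baseDepth_strictMono : StrictMono (baseDepth a P r) :=
  strictMono_nat_of_lt_succ fun n => by
    change baseDepth a P r n < (phase a P r n).depth
    rw [phase_depth, generations]
    omega

theorem baseNodes_subset_range (n : ℕ) :
    baseNodes a P r n ⊆ Finset.range (a.k ^ baseDepth a P r n) := by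
  induction n with
  | zero => simp [baseNodes, baseDepth]
  | succ n ih =>
    refine Finset.sdiff_subset.trans ?_
    rw [phase_nodes, baseDepth, phase_depth]
    exact children_iterate_subset_range ih _

theorem phase_nodes_subset_range (n : ℕ) :
    (phase a P r n).nodes ⊆ Finset.range (a.k ^ (phase a P r n).depth) := by
  rw [phase_nodes, phase_depth]
  exact children_iterate_subset_range (baseNodes_subset_range P r n) _

theorem phase_start_le_of_lt_phaseIndex {n t : ℕ} (hn : n < phaseIndex a P r t) :
    (phase a P r (n + 1)).start ≤ t :=
  not_lt.1 fun hlt => Nat.notMem_of_lt_sInf hn hlt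

theorem phase_start_phaseIndex_le (t : ℕ) : (phase a P r (phaseIndex a P r t)).start ≤ t := by
  cases h : phaseIndex a P r t with
  | zero => exact Nat.zero_le _
  | succ n => exact phase_start_le_of_lt_phaseIndex P r (by omega)

section Admissible

variable (ha : a.Admissible)
include ha

theorem sdiff_eliminated_nonempty {p : Phase} (hp : p.nodes.Nonempty) :
    (p.nodes \ eliminated a P r p).Nonempty := by
  obtain ⟨i, hi, hmax⟩ := Finset.exists_max_image p.nodes (globalMean a P r p) hp
  refine ⟨i, Finset.mem_sdiff.2 ⟨hi, fun hel => ?_⟩⟩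
  obtain ⟨j, hj, -, hlt⟩ := (Finset.mem_filter.1 hel).2
  have hwidth := confWidth_nonneg ha p.depth
  have hcell : 0 ≤ a.ν₁ * a.ρ ^ p.depth := mul_nonneg ha.ν₁_pos.le (pow_nonneg ha.ρ_pos.le _)
  linarith [hmax j hj]

theorem baseNodes_nonempty (n : ℕ) : (baseNodes a P r n).Nonempty := by
  induction n with
  | zero => exact Finset.singleton_nonempty 0
  | succ n ih =>
    refine sdiff_eliminated_nonempty P r ha ?_
    rw [phase_nodes]
    exact children_iterate_nonempty ha.k_pos ih _

theorem phase_nodes_nonempty (n : ℕ) : (phase a P r n).nodes.Nonempty := by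
  rw [phase_nodes]
  exact children_iterate_nonempty ha.k_pos (baseNodes_nonempty P r ha n) _

theorem phase_start_strictMono : StrictMono fun n => (phase a P r n).start :=
  strictMono_nat_of_lt_succ fun n =>
    Nat.lt_add_of_pos_right (Nat.mul_pos (phase_nodes_nonempty P r ha n).card_pos (pulls_pos ha _))

theorem lt_phase_start_phaseIndex_succ (t : ℕ) :
    t < (phase a P r (phaseIndex a P r t + 1)).start := by
  have hne : {n : ℕ | t < (phase a P r (n + 1)).start}.Nonempty :=
    ⟨t, Nat.lt_of_succ_le (phase_start_strictMono P r ha).le_apply⟩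
  exact Nat.sInf_mem hne

theorem nodeAt_phaseIndex_mem (t : ℕ) :
    (phase a P r (phaseIndex a P r t)).nodeAt a t ∈ (phase a P r (phaseIndex a P r t)).nodes :=
  nodeAt_mem (pulls_pos ha _) (phase_start_phaseIndex_le P r t)
    (lt_phase_start_phaseIndex_succ P r ha t)

theorem card_filter_phaseIndex_le (T n : ℕ) :
    ((Finset.range T).filter fun t => phaseIndex a P r t = n).card ≤ (phase a P r n).length a := by
  have hsub : (Finset.range T).filter (fun t => phaseIndex a P r t = n) ⊆
      Finset.Ico (phase a P r n).start ((phase a P r n).start + (phase a P r n).length a) := by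
    intro t ht
    obtain ⟨-, rfl⟩ := Finset.mem_filter.1 ht
    exact Finset.mem_Ico.2
      ⟨phase_start_phaseIndex_le P r t, lt_phase_start_phaseIndex_succ P r ha t⟩
  simpa using Finset.card_le_card hsub

end Admissible

/-! ### Causality -/

variable {P r} {r' : Fin a.M → ℕ → X → ℝ}

theorem globalMean_congr {p : Phase}
    (h : ∀ m, ∀ t ∈ Finset.Ico p.start (p.start + p.length a), r m t = r' m t) :
    globalMean a P r p = globalMean a P r' p := by
  funext i
  unfold globalMean localMean
  congr! 4 with m _ t ht
  rw [h m t (Finset.mem_filter.1 ht).1]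

theorem eliminated_congr {p : Phase}
    (h : ∀ m, ∀ t ∈ Finset.Ico p.start (p.start + p.length a), r m t = r' m t) :
    eliminated a P r p = eliminated a P r' p := by
  rw [eliminated, eliminated, globalMean_congr h]

theorem phase_congr {n : ℕ} (h : ∀ m, ∀ t < (phase a P r n).start, r m t = r' m t) :
    phase a P r n = phase a P r' n := by
  induction n with
  | zero => rfl
  | succ n ih =>
    rw [phase_start_succ] at h
    have hprev : phase a P r n = phase a P r' n := ih fun m t ht => h m t (by omega)
    have helim : eliminated a P r (phase a P r n) = eliminated a P r' (phase a P r n) :=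
      eliminated_congr fun m t ht => h m t (Finset.mem_Ico.1 ht).2
    rw [phase, phase, ← hprev, helim]

theorem phase_eq_iff_of_eq_before {n : ℕ} {p : Phase} (h : ∀ m, ∀ t < p.start, r m t = r' m t) :
    phase a P r n = p ↔ phase a P r' n = p := by
  constructor
  · rintro rfl
    exact (phase_congr h).symm
  · rintro rfl
    exact (phase_congr fun m t ht => (h m t ht).symm).symm

end Run

/-! ### Measurability -/

instance : Countable Phase := by
  have hinj : Function.Injective fun p : Phase => (p.start, p.depth, p.nodes) := by
    rintro ⟨⟩ ⟨⟩ h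
    simp_all only [Prod.mk.injEq]
  exact hinj.countable

instance : MeasurableSpace Phase := ⊤

instance : DiscreteMeasurableSpace Phase := ⟨fun _ => trivial⟩

section Measurability

variable {X : Type*} {a : Params} (P : HierarchicalPartition X a.k)

theorem measurable_globalMean (p : Phase) (i : ℕ) :
    Measurable fun r : Fin a.M → ℕ → X → ℝ => globalMean a P r p i := by
  unfold globalMean localMean
  fun_prop

theorem measurable_mem_eliminated (p : Phase) (i : ℕ) :
    Measurable fun r : Fin a.M → ℕ → X → ℝ => i ∈ eliminated a P r p := by
  have hmean := measurable_globalMean (a := a) P p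
  simp only [eliminated, Finset.mem_filter]
  refine measurable_const.and (Measurable.exists fun j => measurable_const.and
    (.and (Measurable.forall fun j' => Measurable.forall fun _ => ?_) ?_))
  · exact measurableSet_setOfPred.1 (measurableSet_le (hmean j') (hmean j))
  · exact measurableSet_setOfPred.1 (measurableSet_lt (((hmean i).add_const _).add_const _)
      ((hmean j).sub_const _))

theorem measurableSet_eliminated_eq (p : Phase) (E : Finset ℕ) :
    MeasurableSet {r : Fin a.M → ℕ → X → ℝ | eliminated a P r p = E} := by
  simp only [Finset.ext_iff]
  exact measurableSet_setOfPred.2 (Measurable.forall fun i =>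
    (measurable_mem_eliminated P p i).iff measurable_const)

theorem measurable_phase (n : ℕ) :
    Measurable fun r : Fin a.M → ℕ → X → ℝ => phase a P r n := by
  let _ : MeasurableSpace (Finset ℕ) := ⊤
  induction n with
  | zero => exact measurable_const
  | succ n ih =>
    let next : Phase × (Fin a.M → ℕ → X → ℝ) → Phase := fun q =>
      openPhase a (q.1.start + q.1.length a) (q.1.depth + 1)
        (children a.k (q.1.nodes \ eliminated a P q.2 q.1))
    have hnext : Measurable next := measurable_from_prod_countable_right fun p =>
      (measurable_from_top (f := fun E : Finset ℕ =>
        openPhase a (p.start + p.length a) (p.depth + 1) (children a.k (p.nodes \ E)))).comp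
        (measurable_to_countable' (measurableSet_eliminated_eq P p))
    exact hnext.comp (ih.prodMk measurable_id)

theorem measurable_phaseIndex (ha : a.Admissible) (t : ℕ) :
    Measurable fun r : Fin a.M → ℕ → X → ℝ => phaseIndex a P r t := by
  have hex : ∀ r : Fin a.M → ℕ → X → ℝ, ∃ n, t < (phase a P r (n + 1)).start := fun r =>
    ⟨_, lt_phase_start_phaseIndex_succ P r ha t⟩
  have hfind : ∀ r, phaseIndex a P r t = Nat.find (hex r) := fun r => by
    rw [eq_comm, Nat.find_eq_iff]
    exact ⟨lt_phase_start_phaseIndex_succ P r ha t,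
      fun n hn => not_lt.2 (phase_start_le_of_lt_phaseIndex P r hn)⟩
  simp only [hfind]
  exact measurable_find hex fun n => measurable_phase P (n + 1) (MeasurableSet.of_discrete
    (s := {p : Phase | t < p.start}))

theorem measurable_regret (ha : a.Admissible) (f : X → ℝ) :
    Measurable fun r : Fin a.M → ℕ → X → ℝ => regret a P r f := by
  simp only [regret, arm_eq]
  refine Finset.measurable_sum _ fun m _ => Finset.measurable_sum _ fun t _ => ?_
  have hphase : Measurable fun r : Fin a.M → ℕ → X → ℝ => phase a P r (phaseIndex a P r t) :=
    (measurable_from_prod_countable_right (f := fun q : ℕ × (Fin a.M → ℕ → X → ℝ) =>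
      phase a P q.2 q.1) (measurable_phase P)).comp
        ((measurable_phaseIndex P ha t).prodMk measurable_id)
  exact (measurable_from_top (f := fun p : Phase =>
    optimum f - f (P.rep p.depth (p.nodeAt a t)))).comp hphase

end Measurability

/-! ### Concentration of the server's estimates -/

/-- The server's estimates in phase `p` lie within the confidence width of the values of `f` at the
representatives. -/
def EstimatesAccurate {X : Type*} (a : Params) (P : HierarchicalPartition X a.k) (f : X → ℝ)
    (r : Fin a.M → ℕ → X → ℝ) (p : Phase) : Prop :=
  ∀ i ∈ p.nodes, |globalMean a P r p i - f (P.rep p.depth i)| ≤ confWidth a p.depth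

/-- The good event of the analysis: the estimates are accurate in every phase that is completed
within the horizon. -/
def Accurate {X : Type*} (a : Params) (P : HierarchicalPartition X a.k) (f : X → ℝ)
    (r : Fin a.M → ℕ → X → ℝ) : Prop :=
  ∀ n, (phase a P r (n + 1)).start ≤ a.T → EstimatesAccurate a P f r (phase a P r n)

/-- The rewards of the rounds in `s`; those of all other rounds are replaced by `0`. -/
def restrictRounds {X : Type*} {M : ℕ} (s : Finset ℕ) (r : Fin M → ℕ → X → ℝ) :
    Fin M → ℕ → X → ℝ :=
  fun m t x => if t ∈ s then r m t x else 0

theorem restrictRounds_of_mem {X : Type*} {M : ℕ} {s : Finset ℕ} (r : Fin M → ℕ → X → ℝ)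
    (m : Fin M) {t : ℕ} (ht : t ∈ s) : restrictRounds s r m t = r m t :=
  funext fun _ => if_pos ht

section Concentration

variable {X Ω : Type*} [MeasurableSpace Ω] {μ : Measure Ω}

/-- The rewards at the sample point `ω`, in the form in which the algorithm reads them. -/
def realization {M : ℕ} (R : Fin M → ℕ → X → Ω → ℝ) (ω : Ω) : Fin M → ℕ → X → ℝ :=
  fun m t x => R m t x ω

theorem RewardModel.measurable_realization {M : ℕ} {floc : Fin M → X → ℝ}
    {R : Fin M → ℕ → X → Ω → ℝ} (hR : RewardModel μ floc R) : Measurable (realization R) :=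
  measurable_pi_iff.2 fun m => measurable_pi_iff.2 fun t => measurable_pi_iff.2 (hR.measurable m t)

theorem RewardModel.indepFun_restrictRounds {M : ℕ} {floc : Fin M → X → ℝ}
    {R : Fin M → ℕ → X → Ω → ℝ} (hR : RewardModel μ floc R) {s s' : Finset ℕ}
    (hs : Disjoint s s') :
    IndepFun (fun ω => restrictRounds s (realization R ω))
      (fun ω => restrictRounds s' (realization R ω)) μ := by
  let extend (s : Finset ℕ) (u : (Finset.univ ×ˢ s : Finset (Fin M × ℕ)) → X → ℝ) :
      Fin M → ℕ → X → ℝ := fun m t x =>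
    if h : t ∈ s then u ⟨(m, t), Finset.mk_mem_product (Finset.mem_univ m) h⟩ x else 0
  have hextend : ∀ s, Measurable (extend s) := fun s => by
    refine measurable_pi_iff.2 fun m => measurable_pi_iff.2 fun t => measurable_pi_iff.2 fun x => ?_
    by_cases h : t ∈ s
    · simp only [extend, h, dite_true]
      fun_prop
    · simp only [extend, h, dite_false]
      fun_prop
  have hind := hR.indep.indepFun_finset (Finset.univ ×ˢ s) (Finset.univ ×ˢ s')
    (Finset.disjoint_product.2 (Or.inr hs)) fun q => measurable_pi_iff.2 (hR.measurable q.1 q.2)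
  exact hind.comp (hextend s) (hextend s')

variable {a : Params} {P : HierarchicalPartition X a.k} {floc : Fin a.M → X → ℝ}
  {R : Fin a.M → ℕ → X → Ω → ℝ}

theorem RewardModel.measure_phase_eq_inter (hR : RewardModel μ floc R) (f : X → ℝ) (n : ℕ)
    (p : Phase) :
    μ ({ω | phase a P (realization R ω) n = p} ∩
        {ω | ¬ EstimatesAccurate a P f (realization R ω) p}) =
      μ {ω | phase a P (realization R ω) n = p} *
        μ {ω | ¬ EstimatesAccurate a P f (realization R ω) p} := by
  let before : Finset ℕ := Finset.range p.start
  let during : Finset ℕ := Finset.Ico p.start (p.start + p.length a)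
  have hdisj : Disjoint before during := Finset.disjoint_left.2 fun t ht ht' =>
    (Finset.mem_range.1 ht).not_ge (Finset.mem_Ico.1 ht').1
  have hind := hR.indepFun_restrictRounds hdisj
  have hphase : ∀ r : Fin a.M → ℕ → X → ℝ,
      phase a P (restrictRounds before r) n = p ↔ phase a P r n = p := fun r =>
    phase_eq_iff_of_eq_before fun m t ht => restrictRounds_of_mem r m (Finset.mem_range.2 ht)
  have hmean : ∀ r : Fin a.M → ℕ → X → ℝ,
      globalMean a P (restrictRounds during r) p = globalMean a P r p := fun r =>
    globalMean_congr fun m t ht => restrictRounds_of_mem r m ht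
  have hacc : MeasurableSet {r : Fin a.M → ℕ → X → ℝ | ¬ EstimatesAccurate a P f r p} :=
    (measurableSet_setOfPred.2 (Measurable.forall fun i => Measurable.forall fun _ =>
      measurableSet_setOfPred.1 (measurableSet_le
        ((measurable_globalMean P p i).sub_const _).abs measurable_const))).compl
  have hprod := hind.measure_inter_preimage_eq_mul _ _
    (measurable_phase P n (measurableSet_singleton p)) hacc
  simpa only [Set.preimage, Set.mem_singleton_iff, Set.mem_ofPred_eq, hphase, EstimatesAccurate,
    hmean] using hprod

theorem mul_globalMean_sub_eq_sum (ha : a.Admissible) (P : HierarchicalPartition X a.k)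
    (floc : Fin a.M → X → ℝ) (r : Fin a.M → ℕ → X → ℝ) {p : Phase} {i : ℕ} (hi : i ∈ p.nodes) :
    ((a.M * pulls a p.depth : ℕ) : ℝ) *
        (globalMean a P r p i - globalObjective floc (P.rep p.depth i)) =
      ∑ q ∈ Finset.univ ×ˢ (Finset.Ico p.start (p.start + p.length a)).filter
          (fun t => p.nodeAt a t = i),
        (r q.1 q.2 (P.rep p.depth i) - floc q.1 (P.rep p.depth i)) := by
  have hM := ha.M_pos
  have hq : (0 : ℝ) < pulls a p.depth := by exact_mod_cast pulls_pos ha p.depth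
  rw [Finset.sum_product]
  simp only [Finset.sum_sub_distrib, Finset.sum_const,
    card_filter_nodeAt (pulls_pos ha p.depth) hi, nsmul_eq_mul, ← Finset.mul_sum]
  rw [globalMean, globalObjective]
  simp only [localMean]
  rw [← Finset.sum_div]
  push_cast
  field_simp

variable [IsProbabilityMeasure μ]

theorem RewardModel.measureReal_confWidth_le_abs_le (hR : RewardModel μ floc R)
    (ha : a.Admissible) (P : HierarchicalPartition X a.k) (p : Phase) {i : ℕ} (hi : i ∈ p.nodes) :
    μ.real {ω | confWidth a p.depth ≤
        |globalMean a P (realization R ω) p i - globalObjective floc (P.rep p.depth i)|}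
      ≤ failureProb a := by
  set s : Finset (Fin a.M × ℕ) := Finset.univ ×ˢ (Finset.Ico p.start (p.start + p.length a)).filter
    (fun t => p.nodeAt a t = i) with hs
  set N : ℝ := ((a.M * pulls a p.depth : ℕ) : ℝ) with hN
  have hNpos : 0 < N := mul_pulls_pos ha p.depth
  have hcard : (s.card : ℝ) = N := by
    rw [hs, Finset.card_product, card_filter_nodeAt (pulls_pos ha p.depth) hi, Finset.card_univ,
      Fintype.card_fin]
  have hind : iIndepFun (fun (q : Fin a.M × ℕ) ω => R q.1 q.2 (P.rep p.depth i) ω) μ :=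
    hR.indep.comp (fun _ y => y (P.rep p.depth i)) fun _ => by fun_prop
  have hoeffding := measureReal_abs_sum_sub_integral_ge_le hind (s := s)
    (fun q _ => (hR.measurable q.1 q.2 _).aemeasurable) (fun q _ => hR.mem_Icc q.1 q.2 _)
    (mul_nonneg hNpos.le (confWidth_nonneg ha p.depth))
  have hexponent : -2 * (N * confWidth a p.depth) ^ 2 / N = -2 * (a.c ^ 2 * logTerm a) := by
    rw [← mul_confWidth_sq ha p.depth, ← hN]
    field_simp
  rw [hcard, hexponent] at hoeffding
  refine le_of_eq_of_le ?_ hoeffding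
  congr 1 with ω
  have hsum := mul_globalMean_sub_eq_sum ha P floc (realization R ω) hi
  simp only [realization] at hsum
  simp only [Set.mem_ofPred_eq, hR.mean]
  rw [← hsum, ← hN, abs_mul, abs_of_pos hNpos, mul_le_mul_iff_right₀ hNpos]

theorem RewardModel.measure_not_estimatesAccurate_le (hR : RewardModel μ floc R)
    (ha : a.Admissible) (P : HierarchicalPartition X a.k) (p : Phase) :
    μ {ω | ¬ EstimatesAccurate a P (globalObjective floc) (realization R ω) p} ≤
      p.nodes.card * ENNReal.ofReal (failureProb a) := by
  calc μ {ω | ¬ EstimatesAccurate a P (globalObjective floc) (realization R ω) p}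
      ≤ μ (⋃ i ∈ p.nodes, {ω | confWidth a p.depth ≤
          |globalMean a P (realization R ω) p i - globalObjective floc (P.rep p.depth i)|}) := by
        refine measure_mono fun ω hω => ?_
        simp only [EstimatesAccurate, Set.mem_ofPred_eq, not_forall, not_le] at hω
        obtain ⟨i, hi, hlt⟩ := hω
        exact Set.mem_biUnion hi hlt.le
    _ ≤ ∑ i ∈ p.nodes, μ {ω | confWidth a p.depth ≤
          |globalMean a P (realization R ω) p i - globalObjective floc (P.rep p.depth i)|} :=
        measure_biUnion_finset_le _ _
    _ ≤ ∑ _i ∈ p.nodes, ENNReal.ofReal (failureProb a) := Finset.sum_le_sum fun _ hi => by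
        rw [← ofReal_measureReal (measure_ne_top _ _)]
        exact ENNReal.ofReal_le_ofReal (hR.measureReal_confWidth_le_abs_le ha P p hi)
    _ = p.nodes.card * ENNReal.ofReal (failureProb a) := by rw [Finset.sum_const, nsmul_eq_mul]

theorem RewardModel.measure_phase_not_accurate_le (hR : RewardModel μ floc R) (ha : a.Admissible)
    (P : HierarchicalPartition X a.k) (n : ℕ) :
    μ {ω | (phase a P (realization R ω) (n + 1)).start ≤ a.T ∧
        ¬ EstimatesAccurate a P (globalObjective floc) (realization R ω)
          (phase a P (realization R ω) n)} ≤
      a.T * ENNReal.ofReal (failureProb a) := by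
  refine measure_setOf_mem_apply_le (Z := fun ω => phase a P (realization R ω) n)
    (A := fun p => {ω | p.start + p.length a ≤ a.T ∧
      ¬ EstimatesAccurate a P (globalObjective floc) (realization R ω) p})
    (fun p => hR.measurable_realization (measurable_phase P n (measurableSet_singleton p)))
    fun p => ?_
  by_cases hp : p.start + p.length a ≤ a.T
  · have hcard : p.nodes.card ≤ a.T := by
      have hlength : p.nodes.card ≤ p.length a := Nat.le_mul_of_pos_right _ (pulls_pos ha _)
      omega
    simp only [hp, true_and]
    refine (hR.measure_phase_eq_inter _ n p).trans_le (mul_le_mul_right ?_ _)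
    refine (hR.measure_not_estimatesAccurate_le ha P p).trans ?_
    gcongr
  · simp [hp]

theorem RewardModel.measureReal_not_accurate_le (hR : RewardModel μ floc R) (ha : a.Admissible)
    (P : HierarchicalPartition X a.k) :
    μ.real {ω | ¬ Accurate a P (globalObjective floc) (realization R ω)} ≤
      a.T ^ 2 * failureProb a := by
  have hε : 0 ≤ failureProb a := by unfold failureProb; positivity
  refine ENNReal.toReal_le_of_le_ofReal (by positivity) ?_
  calc μ {ω | ¬ Accurate a P (globalObjective floc) (realization R ω)}
      ≤ μ (⋃ n ∈ Finset.range a.T, {ω | (phase a P (realization R ω) (n + 1)).start ≤ a.T ∧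
          ¬ EstimatesAccurate a P (globalObjective floc) (realization R ω)
            (phase a P (realization R ω) n)}) := by
        refine measure_mono fun ω hω => ?_
        simp only [Accurate, Set.mem_ofPred_eq, not_forall] at hω
        obtain ⟨n, hn, hbad⟩ := hω
        have hstart := (phase_start_strictMono P (realization R ω) ha).le_apply (x := n + 1)
        exact Set.mem_biUnion (Finset.mem_coe.2 (Finset.mem_range.2 (by omega))) ⟨hn, hbad⟩
    _ ≤ ∑ _n ∈ Finset.range a.T, a.T * ENNReal.ofReal (failureProb a) :=
        (measure_biUnion_finset_le _ _).trans
          (Finset.sum_le_sum fun _ _ => hR.measure_phase_not_accurate_le ha P _)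
    _ = ENNReal.ofReal (a.T ^ 2 * failureProb a) := by
        rw [Finset.sum_const, Finset.card_range, nsmul_eq_mul, ← mul_assoc,
          ENNReal.ofReal_mul (by positivity), ENNReal.ofReal_pow (by positivity),
          ENNReal.ofReal_natCast, sq]

end Concentration

/-! ### Optimal nodes -/

/-- The node `(h, i)` is optimal: `f` takes values arbitrarily close to `f*` on its cell. The
supremum need not be attained. -/
def IsOptimalNode {X : Type*} {k : ℕ} (P : HierarchicalPartition X k) (f : X → ℝ) (h i : ℕ) :
    Prop :=
  ∀ ε > 0, ∃ x ∈ P.cell h i, optimum f - f x < ε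

section Optimal

variable {X : Type*} {k : ℕ} {P : HierarchicalPartition X k} {f : X → ℝ}

theorem HierarchicalPartition.mem_cell_iff (P : HierarchicalPartition X k) {h i : ℕ}
    (hi : i < k ^ h) {x : X} : x ∈ P.cell h i ↔ ∃ j < k, x ∈ P.cell (h + 1) (k * i + j) := by
  simp only [P.cell_children h i hi, Set.mem_iUnion, Finset.mem_range, exists_prop]

theorem HierarchicalPartition.exists_cell_subset (P : HierarchicalPartition X k) {h : ℕ}
    {K : Finset ℕ} (hK : K ⊆ Finset.range (k ^ h)) {j i : ℕ} (hi : i ∈ (children k)^[j] K) :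
    ∃ i' ∈ K, P.cell (h + j) i ⊆ P.cell h i' := by
  induction j generalizing i with
  | zero => exact ⟨i, hi, subset_rfl⟩
  | succ j ih =>
    rw [Function.iterate_succ_apply'] at hi
    obtain ⟨i₁, hi₁, u, hu, rfl⟩ := mem_children.1 hi
    obtain ⟨i', hi', hsub⟩ := ih hi₁
    have hlt := Finset.mem_range.1 (children_iterate_subset_range hK j hi₁)
    exact ⟨i', hi', fun x hx => hsub ((P.mem_cell_iff hlt).2 ⟨u, hu, hx⟩)⟩

theorem isOptimalNode_root (P : HierarchicalPartition X k) (f : X → ℝ) :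
    IsOptimalNode P f 0 0 := by
  intro ε hε
  have : Nonempty X := ⟨P.rep 0 0⟩
  obtain ⟨x, hx⟩ := exists_lt_of_lt_ciSup (sub_lt_self (optimum f) hε)
  exact ⟨x, P.cell_zero ▸ Set.mem_univ x, by linarith⟩

theorem IsOptimalNode.exists_child {h i : ℕ} (hopt : IsOptimalNode P f h i) (hi : i < k ^ h) :
    ∃ j < k, IsOptimalNode P f (h + 1) (k * i + j) := by
  by_contra! hcon
  simp only [IsOptimalNode, not_forall, not_exists, not_and, not_lt] at hcon
  choose! ε hε hgap using hcon
  have hk : 0 < k := by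
    obtain ⟨x, hx, -⟩ := hopt 1 one_pos
    obtain ⟨j, hj, -⟩ := (P.mem_cell_iff hi).1 hx
    omega
  obtain ⟨j₀, hj₀, hmin⟩ := Finset.exists_min_image (Finset.range k) ε
    (Finset.nonempty_range_iff.2 hk.ne')
  obtain ⟨x, hx, hlt⟩ := hopt (ε j₀) (hε j₀ (Finset.mem_range.1 hj₀))
  obtain ⟨j, hj, hxj⟩ := (P.mem_cell_iff hi).1 hx
  linarith [hgap j hj x hxj, hmin j (Finset.mem_range.2 hj)]

theorem exists_isOptimalNode_children_iterate {h : ℕ} {K : Finset ℕ}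
    (hK : K ⊆ Finset.range (k ^ h)) (hopt : ∃ i ∈ K, IsOptimalNode P f h i) (j : ℕ) :
    ∃ i ∈ (children k)^[j] K, IsOptimalNode P f (h + j) i := by
  induction j with
  | zero => exact hopt
  | succ j ih =>
    obtain ⟨i, hi, hiopt⟩ := ih
    obtain ⟨u, hu, huopt⟩ :=
      hiopt.exists_child (Finset.mem_range.1 (children_iterate_subset_range hK j hi))
    rw [Function.iterate_succ_apply']
    exact ⟨k * i + u, mem_children.2 ⟨i, hi, u, hu, rfl⟩, huopt⟩

variable {ℓ : X → X → ℝ} {ν₁ ρ : ℝ}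

theorem LocalSmoothness.sub_le_of_isOptimalNode (hs : LocalSmoothness P ℓ f ν₁ ρ) {h i : ℕ}
    (hi : i < k ^ h) (hopt : IsOptimalNode P f h i) {y : X} (hy : y ∈ P.cell h i) :
    optimum f - f y ≤ ν₁ * ρ ^ h := by
  refine le_of_forall_pos_le_add fun ε hε => ?_
  obtain ⟨x, hx, hxε⟩ := hopt (ε / 2) (half_pos hε)
  have hlip := hs.weak_lipschitz x y
  have hdiam := hs.diam_le h i hi x hx y hy
  have hnonneg := hs.dissim_nonneg x y
  have hmax : max (optimum f - f x) (ℓ x y) ≤ ε / 2 + ν₁ * ρ ^ h :=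
    max_le (by linarith) (by linarith)
  linarith

theorem LocalSmoothness.sub_le_two_mul (hs : LocalSmoothness P ℓ f ν₁ ρ) {h i : ℕ}
    (hi : i < k ^ h) {B : ℝ} (hB : ν₁ * ρ ^ h ≤ B) {x y : X} (hx : x ∈ P.cell h i)
    (hxB : optimum f - f x ≤ B) (hy : y ∈ P.cell h i) : optimum f - f y ≤ 2 * B := by
  have hlip := hs.weak_lipschitz x y
  have hmax : max (optimum f - f x) (ℓ x y) ≤ B :=
    max_le hxB ((hs.diam_le h i hi x hx y hy).trans hB)
  linarith

theorem NearOptimalityDimension.one_le {C d : ℝ} (hdim : NearOptimalityDimension P f ν₁ ρ C d)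
    (hν₁ : 0 ≤ ν₁) (hs : LocalSmoothness P ℓ f ν₁ ρ) : 1 ≤ C := by
  have hroot := hs.sub_le_of_isOptimalNode (by simp) (isOptimalNode_root P f)
    (P.rep_mem 0 0 (by simp))
  have hmem : 0 ∈ nearOptimalNodes P f 0 (6 * ν₁ * ρ ^ 0) := by
    refine Finset.mem_filter.2 ⟨by simp, hroot.trans ?_⟩
    simp only [pow_zero, mul_one]
    linarith
  have hcard : (1 : ℝ) ≤ (nearOptimalNodes P f 0 (6 * ν₁ * ρ ^ 0)).card := by
    exact_mod_cast Finset.card_pos.2 ⟨0, hmem⟩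
  simpa using hcard.trans (hdim 0)

end Optimal

/-! ### Survival of optimal nodes -/

section Survival

variable {X : Type*} {a : Params} {P : HierarchicalPartition X a.k} {f : X → ℝ} {ℓ : X → X → ℝ}
  {r : Fin a.M → ℕ → X → ℝ}

section Phase

variable (ha : a.Admissible) (hs : LocalSmoothness P ℓ f a.ν₁ a.ρ) {p : Phase}
  (hacc : EstimatesAccurate a P f r p) {i : ℕ} (hi : i ∈ p.nodes) (hlt : i < a.k ^ p.depth)
  (hopt : IsOptimalNode P f p.depth i)
include hs hacc hi hlt hopt

theorem notMem_eliminated_of_isOptimalNode (hf : ∀ x, f x ≤ optimum f) :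
    i ∉ eliminated a P r p := by
  intro hel
  obtain ⟨j, hj, -, hgap⟩ := (Finset.mem_filter.1 hel).2
  have hreg := hs.sub_le_of_isOptimalNode hlt hopt (P.rep_mem _ _ hlt)
  have hacci := abs_le.1 (hacc i hi)
  have haccj := abs_le.1 (hacc j hj)
  linarith [hf (P.rep p.depth j)]

include ha in
theorem sub_rep_le_of_mem_sdiff_eliminated {i' : ℕ} (hi' : i' ∈ p.nodes \ eliminated a P r p) :
    optimum f - f (P.rep p.depth i') ≤ 6 * a.ν₁ * a.ρ ^ p.depth := by
  obtain ⟨hnode, hsurvives⟩ := Finset.mem_sdiff.1 hi'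
  obtain ⟨j, hj, hmax⟩ := Finset.exists_max_image p.nodes (globalMean a P r p) ⟨i', hnode⟩
  have hgap : globalMean a P r p j - confWidth a p.depth ≤
      globalMean a P r p i' + confWidth a p.depth + a.ν₁ * a.ρ ^ p.depth :=
    not_lt.1 fun hlt => hsurvives (Finset.mem_filter.2 ⟨hnode, j, hj, hmax, hlt⟩)
  have hreg := hs.sub_le_of_isOptimalNode hlt hopt (P.rep_mem _ _ hlt)
  have hacci := abs_le.1 (hacc i hi)
  have hacci' := abs_le.1 (hacc i' hnode)
  linarith [confWidth_le ha p.depth, hmax i hi]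

end Phase

variable (ha : a.Admissible) (hs : LocalSmoothness P ℓ f a.ν₁ a.ρ) (hf : ∀ x, f x ≤ optimum f)
  (hr : Accurate a P f r)

theorem exists_isOptimalNode_phase_nodes {n : ℕ}
    (hopt : ∃ i ∈ baseNodes a P r n, IsOptimalNode P f (baseDepth a P r n) i) :
    ∃ i ∈ (phase a P r n).nodes, IsOptimalNode P f (phase a P r n).depth i := by
  rw [phase_nodes, phase_depth]
  exact exists_isOptimalNode_children_iterate (baseNodes_subset_range P r n) hopt _

include hs hf hr in
theorem exists_isOptimalNode_baseNodes {n : ℕ} (hn : (phase a P r n).start ≤ a.T) :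
    ∃ i ∈ baseNodes a P r n, IsOptimalNode P f (baseDepth a P r n) i := by
  induction n with
  | zero => exact ⟨0, Finset.mem_singleton_self 0, isOptimalNode_root P f⟩
  | succ n ih =>
    obtain ⟨i, hi, hopt⟩ := exists_isOptimalNode_phase_nodes (ih ((Nat.le_add_right _ _).trans hn))
    have hlt := Finset.mem_range.1 (phase_nodes_subset_range P r n hi)
    exact ⟨i, Finset.mem_sdiff.2
      ⟨hi, notMem_eliminated_of_isOptimalNode hs (hr n hn) hi hlt hopt hf⟩, hopt⟩

include ha hs hf hr

theorem sub_rep_baseNodes_le {n : ℕ} (hn : (phase a P r n).start ≤ a.T) {i : ℕ}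
    (hi : i ∈ baseNodes a P r n) :
    optimum f - f (P.rep (baseDepth a P r n) i) ≤ 6 * a.ν₁ * a.ρ ^ baseDepth a P r n := by
  cases n with
  | zero =>
    obtain rfl := Finset.mem_singleton.1 hi
    have hroot := hs.sub_le_of_isOptimalNode one_pos (isOptimalNode_root P f)
      (P.rep_mem 0 0 one_pos)
    simp only [baseDepth, pow_zero, mul_one] at hroot ⊢
    linarith [ha.ν₁_pos]
  | succ n =>
    obtain ⟨i₀, hi₀, hopt⟩ := exists_isOptimalNode_phase_nodes
      (exists_isOptimalNode_baseNodes hs hf hr ((Nat.le_add_right _ _).trans hn))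
    have hlt := Finset.mem_range.1 (phase_nodes_subset_range P r n hi₀)
    exact sub_rep_le_of_mem_sdiff_eliminated ha hs (hr n hn) hi₀ hlt hopt hi

theorem sub_rep_phase_nodes_le {n : ℕ} (hn : (phase a P r n).start ≤ a.T) {i : ℕ}
    (hi : i ∈ (phase a P r n).nodes) :
    optimum f - f (P.rep (phase a P r n).depth i) ≤ 12 * a.ν₁ * a.ρ ^ baseDepth a P r n := by
  have hmem := P.rep_mem _ _ (Finset.mem_range.1 (phase_nodes_subset_range P r n hi))
  rw [phase_nodes] at hi
  obtain ⟨i', hi', hsub⟩ := P.exists_cell_subset (baseNodes_subset_range P r n) hi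
  rw [← phase_depth] at hsub
  have hlt := Finset.mem_range.1 (baseNodes_subset_range P r n hi')
  have hnonneg : 0 ≤ a.ν₁ * a.ρ ^ baseDepth a P r n :=
    mul_nonneg ha.ν₁_pos.le (pow_nonneg ha.ρ_pos.le _)
  linarith [hs.sub_le_two_mul hlt (by linarith) (P.rep_mem _ _ hlt)
    (sub_rep_baseNodes_le ha hs hf hr hn hi') (hsub hmem)]

theorem card_baseNodes_le {C d : ℝ} (hdim : NearOptimalityDimension P f a.ν₁ a.ρ C d) {n : ℕ}
    (hn : (phase a P r n).start ≤ a.T) :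
    ((baseNodes a P r n).card : ℝ) ≤ C * (a.ρ ^ baseDepth a P r n) ^ (-d) :=
  le_trans (Nat.cast_le.2 (Finset.card_le_card fun _ hi => Finset.mem_filter.2
    ⟨baseNodes_subset_range P r n hi, sub_rep_baseNodes_le ha hs hf hr hn hi⟩))
    (hdim (baseDepth a P r n))

end Survival

/-! ### The length of a phase -/

section Length

variable {a : Params} {Q : ℝ}

theorem level_le_of_mustExpand (ha : a.Admissible) {h : ℕ} {K : Finset ℕ} (hK : K.Nonempty)
    (hguard : MustExpand a h K) : level a h ≤ a.M := by
  refine (level_le_threshold a h).trans (Nat.cast_le.2 ?_)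
  rcases hguard with hcard | hone
  · exact (Nat.le_mul_of_pos_left _ hK.card_pos).trans hcard
  · exact hone.trans ha.one_le_M

theorem card_mul_level_le_of_mustExpand (ha : a.Admissible) {h : ℕ} {K : Finset ℕ}
    (hguard : MustExpand a h K) (hQ : 1 ≤ Q) (hKQ : (K.card : ℝ) ≤ Q) :
    K.card * level a h ≤ a.M * Q := by
  have hM : (1 : ℝ) ≤ a.M := by exact_mod_cast ha.one_le_M
  have hlevel := level_le_threshold a h
  rcases hguard with hcard | hone
  · have hcard' : (K.card : ℝ) * threshold a h ≤ a.M := by exact_mod_cast hcard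
    calc (K.card : ℝ) * level a h ≤ K.card * threshold a h := by gcongr
      _ ≤ a.M := hcard'
      _ ≤ a.M * Q := le_mul_of_one_le_right (by linarith) hQ
  · have hone' : (threshold a h : ℝ) ≤ 1 := by exact_mod_cast hone
    calc (K.card : ℝ) * level a h ≤ Q * a.M :=
          mul_le_mul hKQ (by linarith) (level_pos ha h).le (by linarith)
      _ = a.M * Q := mul_comm _ _

theorem card_le_of_level_le (hQ : ∀ h, level a h ≤ a.M → (a.k : ℝ) ^ h ≤ Q) {h : ℕ}
    {K : Finset ℕ} (hK : K ⊆ Finset.range (a.k ^ h)) (hlevel : level a h ≤ a.M) :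
    (K.card : ℝ) ≤ Q := by
  have hcard : K.card ≤ a.k ^ h := by simpa using Finset.card_le_card hK
  exact le_trans (by exact_mod_cast hcard) (hQ h hlevel)

theorem mul_children_pulls_le_of_mustExpand (ha : a.Admissible)
    (hQ : ∀ h, level a h ≤ a.M → (a.k : ℝ) ^ h ≤ Q) {h : ℕ} {K : Finset ℕ} (hK : K.Nonempty)
    (hKh : K ⊆ Finset.range (a.k ^ h)) (hguard : MustExpand a h K) :
    (a.M : ℝ) * (a.k * K.card * pulls a (h + 1)) ≤ 2 * a.k * (a.ρ ^ 2)⁻¹ * (a.M * Q) := by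
  have hρ : 1 ≤ (a.ρ ^ 2)⁻¹ :=
    (one_le_inv₀ (pow_pos ha.ρ_pos 2)).2 (pow_le_one₀ ha.ρ_pos.le ha.ρ_lt_one.le)
  have hKQ := card_le_of_level_le hQ hKh (level_le_of_mustExpand ha hK hguard)
  have hK1 : (1 : ℝ) ≤ K.card := by exact_mod_cast hK.card_pos
  have hprod := card_mul_level_le_of_mustExpand ha hguard (hK1.trans hKQ) hKQ
  have hpulls := mul_pulls_le ha (h + 1)
  rw [level_succ] at hpulls
  calc (a.M : ℝ) * (a.k * K.card * pulls a (h + 1))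
      = a.k * K.card * (a.M * pulls a (h + 1)) := by ring
    _ ≤ a.k * K.card * ((a.ρ ^ 2)⁻¹ * level a h + a.M) := by gcongr
    _ = a.k * ((a.ρ ^ 2)⁻¹ * (K.card * level a h) + 1 * (a.M * K.card)) := by ring
    _ ≤ a.k * ((a.ρ ^ 2)⁻¹ * (a.M * Q) + (a.ρ ^ 2)⁻¹ * (a.M * Q)) := by gcongr
    _ = 2 * a.k * (a.ρ ^ 2)⁻¹ * (a.M * Q) := by ring

theorem mul_children_pulls_le (ha : a.Admissible)
    (hQ : ∀ h, level a h ≤ a.M → (a.k : ℝ) ^ h ≤ Q) {h : ℕ} {K : Finset ℕ}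
    (hKh : K ⊆ Finset.range (a.k ^ h)) :
    (a.M : ℝ) * (a.k * K.card * pulls a (h + 1)) ≤ 2 * a.k * (a.ρ ^ 2)⁻¹ * (a.M * Q) ∨
    (a.M : ℝ) * (a.k * K.card * pulls a (h + 1)) ≤ 2 * a.k * K.card * level a (h + 1) := by
  have hpulls := mul_pulls_le ha (h + 1)
  by_cases hlevel : level a (h + 1) ≤ a.M
  · left
    have hρ : 1 ≤ (a.ρ ^ 2)⁻¹ :=
      (one_le_inv₀ (pow_pos ha.ρ_pos 2)).2 (pow_le_one₀ ha.ρ_pos.le ha.ρ_lt_one.le)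
    have hKQ : (K.card : ℝ) ≤ Q := card_le_of_level_le hQ
      (hKh.trans (Finset.range_mono (Nat.pow_le_pow_right ha.k_pos h.le_succ))) hlevel
    have hQ0 : 0 ≤ Q := K.card.cast_nonneg.trans hKQ
    have hpulls_le : (a.M : ℝ) * pulls a (h + 1) ≤ 2 * a.M := by linarith
    calc (a.M : ℝ) * (a.k * K.card * pulls a (h + 1))
        = a.k * K.card * (a.M * pulls a (h + 1)) := by ring
      _ ≤ a.k * Q * (2 * a.M) :=
          mul_le_mul (by gcongr) hpulls_le (by positivity) (by positivity)
      _ = 2 * a.k * 1 * (a.M * Q) := by ring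
      _ ≤ 2 * a.k * (a.ρ ^ 2)⁻¹ * (a.M * Q) := by gcongr
  · right
    calc (a.M : ℝ) * (a.k * K.card * pulls a (h + 1))
        = a.k * K.card * (a.M * pulls a (h + 1)) := by ring
      _ ≤ a.k * K.card * (2 * level a (h + 1)) :=
          mul_le_mul_of_nonneg_left (by linarith) (by positivity)
      _ = 2 * a.k * K.card * level a (h + 1) := by ring

variable {X : Type*} (P : HierarchicalPartition X a.k) (r : Fin a.M → ℕ → X → ℝ)

theorem phase_length_eq {n j : ℕ} (hj : generations a P r n = j + 1) :
    (phase a P r n).length a =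
      a.k * ((children a.k)^[j] (baseNodes a P r n)).card *
        pulls a (baseDepth a P r n + j + 1) := by
  rw [Phase.length, phase_nodes, phase_depth, hj, Function.iterate_succ_apply', card_children,
    ← add_assoc]

/-- The first case is that of a phase for which the expansion loop is entered, where the guard
bounds the number of nodes, or for which the level is at most `M` anyway. -/
theorem mul_length_le (ha : a.Admissible) (hQ : ∀ h, level a h ≤ a.M → (a.k : ℝ) ^ h ≤ Q)
    (n : ℕ) :
    (a.M : ℝ) * (phase a P r n).length a ≤ 2 * a.k * (a.ρ ^ 2)⁻¹ * (a.M * Q) ∨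
    (a.M : ℝ) * (phase a P r n).length a ≤
      2 * a.k * (baseNodes a P r n).card * level a (baseDepth a P r n + 1) := by
  have hrange := baseNodes_subset_range P r n
  obtain ⟨j, hj⟩ : ∃ j, generations a P r n = j + 1 := ⟨_, add_comm _ _⟩
  rw [phase_length_eq P r hj]
  push_cast
  cases j with
  | zero => exact mul_children_pulls_le ha hQ hrange
  | succ j =>
    exact .inl (mul_children_pulls_le_of_mustExpand ha hQ
      (children_iterate_nonempty ha.k_pos (baseNodes_nonempty P r ha n) _)
      (children_iterate_subset_range hrange _)
      (mustExpand_of_lt_generations P r (by omega)))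

end Length

/-! ### The regret when the estimates are accurate -/

/-- A phase opened from `C ρ ^ (-d g)` nodes of depth `g` without an expansion costs a regret of
`branchingCost a C` times `ρ ^ (-(d + 1) g)`. -/
noncomputable def branchingCost (a : Params) (C : ℝ) : ℝ :=
  24 * a.k * C * a.c ^ 2 * logTerm a / a.ν₁ * (a.ρ ^ 2)⁻¹

theorem mul_level_succ_mul_eq {a : Params} (ha : a.Admissible) (C d : ℝ) (g : ℕ) :
    2 * a.k * (C * (a.ρ ^ g) ^ (-d)) * level a (g + 1) * (12 * a.ν₁ * a.ρ ^ g) =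
      branchingCost a C * (a.ρ ^ (-(d + 1))) ^ g := by
  have hρ := ha.ρ_pos
  have hν₁ := ha.ν₁_pos
  have hpow : (a.ρ ^ (-(d + 1))) ^ g = (a.ρ ^ g) ^ (-d) * (a.ρ ^ g)⁻¹ := by
    rw [rpow_neg_pow_eq hρ.le, neg_add, Real.rpow_add (by positivity), Real.rpow_neg_one]
  rw [hpow, branchingCost, level, mul_add_one, add_comm, two_mul g, pow_add, pow_add]
  field_simp
  ring

section Run

variable {X : Type*} {a : Params} (P : HierarchicalPartition X a.k) (r : Fin a.M → ℕ → X → ℝ)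

/-- The indices of the phases to which the rounds before the horizon belong. -/
noncomputable def visitedPhases : Finset ℕ := (Finset.range a.T).image (phaseIndex a P r)

/-- The number of rounds of phase `n` before the horizon. -/
noncomputable def roundsIn (n : ℕ) : ℕ :=
  ((Finset.range a.T).filter fun t => phaseIndex a P r t = n).card

theorem phase_start_le_of_mem_visitedPhases {n : ℕ} (hn : n ∈ visitedPhases P r) :
    (phase a P r n).start ≤ a.T := by
  obtain ⟨t, ht, rfl⟩ := Finset.mem_image.1 hn
  exact (phase_start_phaseIndex_le P r t).trans (Finset.mem_range.1 ht).le

theorem sum_roundsIn : ∑ n ∈ visitedPhases P r, (roundsIn P r n : ℝ) = a.T := by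
  have hcard := Finset.card_eq_sum_card_image (phaseIndex a P r) (Finset.range a.T)
  rw [Finset.card_range] at hcard
  exact_mod_cast hcard.symm

variable {P r} {f : X → ℝ} {ℓ : X → X → ℝ} {C d Q : ℝ} (ha : a.Admissible)
  (hs : LocalSmoothness P ℓ f a.ν₁ a.ρ) (hf : ∀ x, f x ≤ optimum f) (hr : Accurate a P f r)
include ha hs hf hr

theorem regret_le_sum_visitedPhases :
    regret a P r f ≤ ∑ n ∈ visitedPhases P r,
      a.M * roundsIn P r n * (12 * a.ν₁ * a.ρ ^ baseDepth a P r n) := by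
  let cost : ℕ → ℝ := fun n => 12 * a.ν₁ * a.ρ ^ baseDepth a P r n
  have hround : ∀ t ∈ Finset.range a.T, ∀ m,
      optimum f - f (arm a P r m t) ≤ cost (phaseIndex a P r t) := fun t ht _ =>
    sub_rep_phase_nodes_le ha hs hf hr
      (phase_start_le_of_mem_visitedPhases P r (Finset.mem_image_of_mem _ ht))
      (nodeAt_phaseIndex_mem P r ha t)
  calc regret a P r f
      ≤ ∑ _m : Fin a.M, ∑ t ∈ Finset.range a.T, cost (phaseIndex a P r t) :=
        Finset.sum_le_sum fun m _ => Finset.sum_le_sum fun t ht => hround t ht m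
    _ = a.M * ∑ n ∈ visitedPhases P r, roundsIn P r n • cost n := by
        rw [Finset.sum_const, Finset.card_univ, Fintype.card_fin, nsmul_eq_mul,
          Finset.sum_comp cost]
        rfl
    _ = ∑ n ∈ visitedPhases P r, a.M * roundsIn P r n * cost n := by
        simp only [Finset.mul_sum, nsmul_eq_mul, mul_assoc]

variable (hQ : ∀ h, level a h ≤ a.M → (a.k : ℝ) ^ h ≤ Q)
  (hdim : NearOptimalityDimension P f a.ν₁ a.ρ C d)
include hQ hdim

theorem mul_length_mul_pow_le {n : ℕ} (hn : (phase a P r n).start ≤ a.T) :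
    a.M * (phase a P r n).length a * (12 * a.ν₁ * a.ρ ^ baseDepth a P r n) ≤
        24 * a.k * a.ν₁ * (a.ρ ^ 2)⁻¹ * (a.M * Q) * a.ρ ^ baseDepth a P r n ∨
    a.M * (phase a P r n).length a * (12 * a.ν₁ * a.ρ ^ baseDepth a P r n) ≤
        branchingCost a C * (a.ρ ^ (-(d + 1))) ^ baseDepth a P r n := by
  have hρ := ha.ρ_pos
  have hν₁ := ha.ν₁_pos
  refine (mul_length_le P r ha hQ n).imp (fun hshort => ?_) fun hlong => ?_
  · calc _ ≤ 2 * a.k * (a.ρ ^ 2)⁻¹ * (a.M * Q) * (12 * a.ν₁ * a.ρ ^ baseDepth a P r n) := by gcongr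
      _ = _ := by ring
  · have hcard := card_baseNodes_le ha hs hf hr hdim hn
    have hlevel := level_pos ha (baseDepth a P r n + 1)
    rw [← mul_level_succ_mul_eq ha]
    refine mul_le_mul_of_nonneg_right (hlong.trans ?_) (by positivity)
    gcongr

theorem mul_roundsIn_mul_pow_le (hQ0 : 0 ≤ Q) (hC : 0 ≤ C) (J : ℕ) {n : ℕ}
    (hn : (phase a P r n).start ≤ a.T) :
    a.M * roundsIn P r n * (12 * a.ν₁ * a.ρ ^ baseDepth a P r n) ≤
      24 * a.k * a.ν₁ * (a.ρ ^ 2)⁻¹ * (a.M * Q) * a.ρ ^ baseDepth a P r n +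
        branchingCost a C *
          (if baseDepth a P r n < J then (a.ρ ^ (-(d + 1))) ^ baseDepth a P r n else 0) +
        12 * a.ν₁ * a.ρ ^ J * (a.M * roundsIn P r n) := by
  have hρ := ha.ρ_pos
  have hν₁ := ha.ν₁_pos
  have hlog := ha.logTerm_pos
  have hshort : 0 ≤ 24 * a.k * a.ν₁ * (a.ρ ^ 2)⁻¹ * (a.M * Q) * a.ρ ^ baseDepth a P r n := by
    positivity
  have hdeep : 0 ≤ 12 * a.ν₁ * a.ρ ^ J * (a.M * roundsIn P r n) := by positivity
  split_ifs with hJ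
  · have hbranching : 0 ≤ branchingCost a C * (a.ρ ^ (-(d + 1))) ^ baseDepth a P r n := by
      unfold branchingCost
      positivity
    have hrounds : (roundsIn P r n : ℝ) ≤ (phase a P r n).length a :=
      Nat.cast_le.2 (card_filter_phaseIndex_le P r ha a.T n)
    have hlength : a.M * roundsIn P r n * (12 * a.ν₁ * a.ρ ^ baseDepth a P r n) ≤
        a.M * (phase a P r n).length a * (12 * a.ν₁ * a.ρ ^ baseDepth a P r n) := by gcongr
    rcases mul_length_mul_pow_le ha hs hf hr hQ hdim hn with h | h <;> linarith
  · have hpow : a.ρ ^ baseDepth a P r n ≤ a.ρ ^ J :=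
      pow_le_pow_of_le_one hρ.le ha.ρ_lt_one.le (not_lt.1 hJ)
    have hdeeper : a.M * roundsIn P r n * (12 * a.ν₁ * a.ρ ^ baseDepth a P r n) ≤
        a.M * roundsIn P r n * (12 * a.ν₁ * a.ρ ^ J) := by gcongr
    linarith

theorem regret_le_of_accurate (hQ0 : 0 ≤ Q) (hC : 0 ≤ C) (J : ℕ) :
    regret a P r f ≤ 24 * a.k * a.ν₁ / (a.ρ ^ 2 * (1 - a.ρ)) * (a.M * Q) +
      (branchingCost a C * ∑ j ∈ Finset.range J, (a.ρ ^ (-(d + 1))) ^ j +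
        12 * a.ν₁ * a.ρ ^ J * (a.M * a.T)) := by
  have hρ := ha.ρ_pos
  have hν₁ := ha.ν₁_pos
  have hlog := ha.logTerm_pos
  have hcost : 0 ≤ branchingCost a C := by unfold branchingCost; positivity
  have hinj := (baseDepth_strictMono P r).injective
  calc regret a P r f
      ≤ ∑ n ∈ visitedPhases P r, _ := (regret_le_sum_visitedPhases ha hs hf hr).trans
        (Finset.sum_le_sum fun n hn => mul_roundsIn_mul_pow_le ha hs hf hr hQ hdim hQ0 hC J
          (phase_start_le_of_mem_visitedPhases P r hn))
    _ = 24 * a.k * a.ν₁ * (a.ρ ^ 2)⁻¹ * (a.M * Q) *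
          ∑ n ∈ visitedPhases P r, a.ρ ^ baseDepth a P r n +
        branchingCost a C * ∑ n ∈ visitedPhases P r,
          (if baseDepth a P r n < J then (a.ρ ^ (-(d + 1))) ^ baseDepth a P r n else 0) +
        12 * a.ν₁ * a.ρ ^ J * (a.M * a.T) := by
        simp only [Finset.sum_add_distrib, ← Finset.mul_sum, sum_roundsIn]
    _ ≤ 24 * a.k * a.ν₁ * (a.ρ ^ 2)⁻¹ * (a.M * Q) * (1 - a.ρ)⁻¹ +
        branchingCost a C * ∑ j ∈ Finset.range J, (a.ρ ^ (-(d + 1))) ^ j +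
        12 * a.ν₁ * a.ρ ^ J * (a.M * a.T) := by
        gcongr
        · exact sum_pow_le_inv_one_sub hinj hρ.le ha.ρ_lt_one _
        · exact sum_ite_lt_pow_le_sum_range hinj (by positivity) _ J
    _ = _ := by
        rw [div_eq_mul_inv, mul_inv]
        ring

end Run

/-! ### The constants of the bound -/

section Constants

variable {a : Params} {C d : ℝ}

theorem one_lt_rpow_neg_add_one {ρ : ℝ} (hρ₀ : 0 < ρ) (hρ₁ : ρ < 1) (hd : 0 ≤ d) :
    1 < ρ ^ (-(d + 1)) :=
  Real.one_lt_rpow_of_pos_of_lt_one_of_neg hρ₀ hρ₁ (by linarith)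

theorem constC₂_nonneg (ha : a.Admissible) (hC : 0 ≤ C) (hd : 0 ≤ d) :
    0 ≤ constC₂ a.k a.ν₁ a.ρ a.c C d := by
  have hρ := ha.ρ_pos
  have hν₁ := ha.ν₁_pos
  have hq := sub_pos.2 (one_lt_rpow_neg_add_one hρ ha.ρ_lt_one hd)
  unfold constC₂
  positivity

theorem two_mul_branchingCost_rpow_eq (ha : a.Admissible) (hC : 0 ≤ C) (hd : 0 ≤ d) (N : ℝ) :
    2 * ((branchingCost a C * a.ρ ^ (-(d + 1)) * (12 * a.ν₁) ^ (d + 1) /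
        (a.ρ ^ (-(d + 1)) - 1)) ^ (1 / (d + 2)) * N) =
      constC₂ a.k a.ν₁ a.ρ a.c C d * logTerm a ^ (1 / (d + 2)) * N := by
  have hρ := ha.ρ_pos
  have hν₁ := ha.ν₁_pos
  have hq := sub_pos.2 (one_lt_rpow_neg_add_one hρ ha.ρ_lt_one hd)
  have hpow : a.ρ ^ (-(d + 3)) = (a.ρ ^ 2)⁻¹ * a.ρ ^ (-(d + 1)) := by
    rw [show -(d + 3) = -2 + -(d + 1) by ring, Real.rpow_add hρ, Real.rpow_neg hρ.le,
      Real.rpow_two]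
  have hfactor : branchingCost a C * a.ρ ^ (-(d + 1)) * (12 * a.ν₁) ^ (d + 1) /
        (a.ρ ^ (-(d + 1)) - 1) =
      24 * a.k * C * a.c ^ 2 * a.ρ ^ (-(d + 3)) * (12 * a.ν₁) ^ (d + 1) /
        (a.ν₁ * (a.ρ ^ (-(d + 1)) - 1)) * logTerm a := by
    rw [hpow, branchingCost]
    field_simp
  rw [hfactor, Real.mul_rpow (by positivity) ha.logTerm_pos.le, constC₂]
  ring

theorem two_le_constC₂ (ha : a.Admissible) (hc : 2 ≤ a.c) (hν₁ : 1 ≤ a.ν₁) (hC : 1 ≤ C)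
    (hd : 0 ≤ d) : 2 ≤ constC₂ a.k a.ν₁ a.ρ a.c C d := by
  have hρ := ha.ρ_pos
  have hq := sub_pos.2 (one_lt_rpow_neg_add_one hρ ha.ρ_lt_one hd)
  have hk : (1 : ℝ) ≤ a.k := by exact_mod_cast ha.k_pos
  have hρ_pow : a.ρ ^ (-(d + 1)) ≤ a.ρ ^ (-(d + 3)) :=
    Real.rpow_le_rpow_of_exponent_ge hρ ha.ρ_lt_one.le (by linarith)
  have hν₁_pow : a.ν₁ ≤ (12 * a.ν₁) ^ (d + 1) :=
    calc a.ν₁ ≤ (12 * a.ν₁) ^ (1 : ℝ) := by rw [Real.rpow_one]; linarith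
      _ ≤ (12 * a.ν₁) ^ (d + 1) := Real.rpow_le_rpow_of_exponent_le (by linarith) (by linarith)
  have hfactor : 1 ≤ 24 * a.k * C * a.c ^ 2 := by
    have hkC : 1 ≤ a.k * C := one_le_mul_of_one_le_of_one_le hk hC
    have hkCc := one_le_mul_of_one_le_of_one_le hkC (one_le_pow₀ (by linarith : 1 ≤ a.c) (n := 2))
    linarith
  have hbase : 1 ≤ 24 * a.k * C * a.c ^ 2 * a.ρ ^ (-(d + 3)) * (12 * a.ν₁) ^ (d + 1) /
      (a.ν₁ * (a.ρ ^ (-(d + 1)) - 1)) := by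
    rw [one_le_div (by positivity)]
    calc a.ν₁ * (a.ρ ^ (-(d + 1)) - 1) ≤ (12 * a.ν₁) ^ (d + 1) * a.ρ ^ (-(d + 3)) :=
          mul_le_mul hν₁_pow (by linarith) hq.le (by positivity)
      _ = 1 * a.ρ ^ (-(d + 3)) * (12 * a.ν₁) ^ (d + 1) := by ring
      _ ≤ 24 * a.k * C * a.c ^ 2 * a.ρ ^ (-(d + 3)) * (12 * a.ν₁) ^ (d + 1) := by gcongr
  have hroot := Real.one_le_rpow hbase (by positivity : 0 ≤ 1 / (d + 2))
  unfold constC₂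
  linarith

theorem half_le_regretRate (hd : 0 ≤ d) : 1 / 2 ≤ regretRate 1 2 d := by
  have hlog_ge := Real.log_two_gt_d9
  have hlog_le := Real.log_two_lt_d9
  have hpow : (1 : ℝ) ≤ 2 ^ ((d + 1) / (d + 2)) := Real.one_le_rpow one_le_two (by positivity)
  have hexp : 1 / (d + 2) ≤ 1 := (div_le_one (by linarith)).2 (by linarith)
  have hroot : Real.log 2 ≤ Real.log 2 ^ (1 / (d + 2)) :=
    Real.self_le_rpow_of_le_one (by linarith) (by linarith) hexp
  calc (1 : ℝ) / 2 ≤ 1 * Real.log 2 := by linarith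
    _ ≤ 2 ^ ((d + 1) / (d + 2)) * Real.log 2 ^ (1 / (d + 2)) := by gcongr
    _ = regretRate 1 2 d := by simp [regretRate]

theorem regretRate_nonneg (M T : ℕ) (d : ℝ) : 0 ≤ regretRate M T d := by
  have hlog : 0 ≤ Real.log (M * T) := by exact_mod_cast Real.log_natCast_nonneg (M * T)
  unfold regretRate
  positivity

theorem add_M_le_constC₁_mul_rpow (ha : a.Admissible) :
    24 * a.k * a.ν₁ / (a.ρ ^ 2 * (1 - a.ρ)) *
        (a.M * (a.M * (a.ν₁ ^ 2 / a.c ^ 2)) ^ (-(1 / (2 * Real.logb a.k a.ρ)))) + a.M ≤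
      constC₁ a.k a.ν₁ a.ρ a.c * (a.M : ℝ) ^ (1 - 1 / (2 * Real.logb a.k a.ρ)) := by
  have hν₁ := ha.ν₁_pos
  have hM := ha.M_pos
  have hM1 : (1 : ℝ) ≤ a.M := by exact_mod_cast ha.one_le_M
  have hρ := sub_pos.2 ha.ρ_lt_one
  have hs : 0 ≤ -(1 / (2 * Real.logb a.k a.ρ)) :=
    neg_one_div_two_mul_logb_nonneg (by exact_mod_cast ha.two_le_k) ha.ρ_pos ha.ρ_lt_one
  rw [constC₁, sub_eq_add_neg 1 (1 / (2 * Real.logb a.k a.ρ))]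
  set s := -(1 / (2 * Real.logb a.k a.ρ))
  have hM_pow : (a.M : ℝ) ^ (1 + s) = a.M * (a.M : ℝ) ^ s := by
    rw [Real.rpow_add hM, Real.rpow_one]
  calc 24 * a.k * a.ν₁ / (a.ρ ^ 2 * (1 - a.ρ)) * (a.M * (a.M * (a.ν₁ ^ 2 / a.c ^ 2)) ^ s) + a.M
      = 24 * a.k * a.ν₁ / (a.ρ ^ 2 * (1 - a.ρ)) * (a.ν₁ ^ 2 / a.c ^ 2) ^ s *
          (a.M : ℝ) ^ (1 + s) + a.M := by
        rw [hM_pow, Real.mul_rpow hM.le (by positivity)]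
        ring
    _ ≤ 48 * a.k * a.ν₁ / (a.ρ ^ 2 * (1 - a.ρ)) * (a.ν₁ ^ 2 / a.c ^ 2) ^ s *
          (a.M : ℝ) ^ (1 + s) + (a.M : ℝ) ^ (1 + s) := by
        gcongr
        · norm_num
        · exact Real.self_le_rpow_of_one_le hM1 (by linarith)
    _ = (48 * a.k * a.ν₁ / (a.ρ ^ 2 - a.ρ ^ 3) * (a.ν₁ ^ 2 / a.c ^ 2) ^ s + 1) *
          (a.M : ℝ) ^ (1 + s) := by ring

theorem M_le_constC₁_mul_rpow (ha : a.Admissible) :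
    (a.M : ℝ) ≤ constC₁ a.k a.ν₁ a.ρ a.c * (a.M : ℝ) ^ (1 - 1 / (2 * Real.logb a.k a.ρ)) := by
  refine le_trans (le_add_of_nonneg_left ?_) (add_M_le_constC₁_mul_rpow ha)
  have hν₁ := ha.ν₁_pos
  have hρ := sub_pos.2 ha.ρ_lt_one
  positivity

end Constants

/-! ### Levels below the number of clients -/

section Levels

variable {a : Params} (ha : a.Admissible)
include ha

theorem pow_le_of_level_le_of_one_le_logTerm (hlog : 1 ≤ logTerm a) {h : ℕ}
    (hlevel : level a h ≤ a.M) :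
    (a.k : ℝ) ^ h ≤ (a.M * (a.ν₁ ^ 2 / a.c ^ 2)) ^ (-(1 / (2 * Real.logb a.k a.ρ))) := by
  have hc := ha.c_pos
  have hν₁ := ha.ν₁_pos
  have hρ := ha.ρ_pos
  refine pow_le_rpow_of_inv_pow_le (by exact_mod_cast ha.two_le_k) hρ ha.ρ_lt_one ?_
  calc (a.ρ ^ (2 * h))⁻¹ = a.c ^ 2 * 1 / a.ν₁ ^ 2 * (a.ρ ^ (2 * h))⁻¹ * (a.ν₁ ^ 2 / a.c ^ 2) := by
        field_simp
    _ ≤ level a h * (a.ν₁ ^ 2 / a.c ^ 2) := by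
        unfold level
        gcongr
    _ ≤ a.M * (a.ν₁ ^ 2 / a.c ^ 2) := by gcongr

theorem one_lt_level (hc : 2 ≤ a.c) (hν₁ : a.ν₁ ≤ 1) (hlog : Real.log 2 ≤ logTerm a) (h : ℕ) :
    1 < level a h := by
  have hlog_two := Real.log_two_gt_d9
  have hν₁_sq : a.ν₁ ^ 2 ≤ 1 := pow_le_one₀ ha.ν₁_pos.le hν₁
  have hc_sq : (2 : ℝ) ^ 2 ≤ a.c ^ 2 := by gcongr
  have hlevel : 1 < a.c ^ 2 * logTerm a / a.ν₁ ^ 2 := by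
    rw [one_lt_div (pow_pos ha.ν₁_pos 2)]
    calc a.ν₁ ^ 2 < 2 ^ 2 * Real.log 2 := by linarith
      _ ≤ a.c ^ 2 * logTerm a := by gcongr
  exact one_lt_mul_of_lt_of_le hlevel
    ((one_le_inv₀ (pow_pos ha.ρ_pos _)).2 (pow_le_one₀ ha.ρ_pos.le ha.ρ_lt_one.le))

/-- The bound rests on `logTerm a ≥ 1`, which can fail only for `M = 1` and `T = 2`; then, if
`ν₁ ≤ 1`, no level is as small as `M`. -/
theorem pow_le_of_level_le (hcal : a.Calibrated) (hT : 2 ≤ a.T)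
    (hexc : a.M = 1 → a.T = 2 → a.ν₁ ≤ 1) {h : ℕ} (hlevel : level a h ≤ a.M) :
    (a.k : ℝ) ^ h ≤ (a.M * (a.ν₁ ^ 2 / a.c ^ 2)) ^ (-(1 / (2 * Real.logb a.k a.ρ))) := by
  have hMT : a.T ≤ a.M * a.T := Nat.le_mul_of_pos_left _ ha.one_le_M
  have hlog := hcal.log_le_logTerm
  rcases Nat.lt_or_ge 2 (a.M * a.T) with hlarge | hsmall
  · refine pow_le_of_level_le_of_one_le_logTerm ha (hlog.trans' ?_) hlevel
    have hthree : (3 : ℝ) ≤ a.M * a.T := by exact_mod_cast hlarge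
    rw [Real.le_log_iff_exp_le (by linarith)]
    linarith [Real.exp_one_lt_three]
  · have hT2 : a.T = 2 := by omega
    have hM1 : a.M = 1 := by rw [hT2] at hsmall; linarith [ha.one_le_M]
    have hlog_two : Real.log 2 ≤ logTerm a := by simpa [hM1, hT2] using hlog
    rw [hM1, Nat.cast_one] at hlevel
    exact absurd hlevel (one_lt_level ha hcal.two_le_c (hexc hM1 hT2) hlog_two h).not_ge

end Levels

/-! ### The expected regret -/

section Objective

variable {X Ω : Type*} [MeasurableSpace Ω] {μ : Measure Ω} [IsProbabilityMeasure μ] {M : ℕ}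
  {floc : Fin M → X → ℝ} {R : Fin M → ℕ → X → Ω → ℝ} (hR : RewardModel μ floc R)
include hR

theorem RewardModel.floc_mem_Icc (m : Fin M) (x : X) : floc m x ∈ Set.Icc (0 : ℝ) 1 := by
  rw [← hR.mean m 0 x]
  have hint : Integrable (R m 0 x) μ :=
    .of_mem_Icc 0 1 (hR.measurable m 0 x).aemeasurable (hR.mem_Icc m 0 x)
  refine ⟨integral_nonneg_of_ae ((hR.mem_Icc m 0 x).mono fun ω h => h.1), ?_⟩
  simpa using integral_mono_ae hint (integrable_const 1) ((hR.mem_Icc m 0 x).mono fun ω h => h.2)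

theorem RewardModel.globalObjective_mem_Icc (x : X) :
    globalObjective floc x ∈ Set.Icc (0 : ℝ) 1 := by
  have hsum : ∑ m, floc m x ≤ M := by
    simpa using Finset.sum_le_sum fun m (_ : m ∈ Finset.univ) => (hR.floc_mem_Icc m x).2
  exact ⟨div_nonneg (Finset.sum_nonneg fun m _ => (hR.floc_mem_Icc m x).1) M.cast_nonneg,
    div_le_one_of_le₀ hsum M.cast_nonneg⟩

theorem RewardModel.le_optimum (x : X) :
    globalObjective floc x ≤ optimum (globalObjective floc) :=
  le_ciSup ⟨1, Set.forall_mem_range.2 fun y => (hR.globalObjective_mem_Icc y).2⟩ x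

theorem RewardModel.optimum_sub_le_one (x : X) :
    optimum (globalObjective floc) - globalObjective floc x ≤ 1 := by
  have : Nonempty X := ⟨x⟩
  have hoptimum : optimum (globalObjective floc) ≤ 1 :=
    ciSup_le fun y => (hR.globalObjective_mem_Icc y).2
  linarith [(hR.globalObjective_mem_Icc x).1]

end Objective

section Expectation

variable {X Ω : Type*} [MeasurableSpace Ω] {μ : Measure Ω} [IsProbabilityMeasure μ]
  {a : Params} {P : HierarchicalPartition X a.k} {floc : Fin a.M → X → ℝ}
  {R : Fin a.M → ℕ → X → Ω → ℝ} (hR : RewardModel μ floc R)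
include hR

theorem RewardModel.regret_nonneg (r : Fin a.M → ℕ → X → ℝ) :
    0 ≤ regret a P r (globalObjective floc) :=
  Finset.sum_nonneg fun _ _ => Finset.sum_nonneg fun _ _ => sub_nonneg.2 (hR.le_optimum _)

theorem RewardModel.regret_le_mul (r : Fin a.M → ℕ → X → ℝ) :
    regret a P r (globalObjective floc) ≤ a.M * a.T := by
  calc regret a P r (globalObjective floc)
      ≤ ∑ _m : Fin a.M, ∑ _t ∈ Finset.range a.T, (1 : ℝ) :=
        Finset.sum_le_sum fun _ _ => Finset.sum_le_sum fun _ _ => hR.optimum_sub_le_one _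
    _ = a.M * a.T := by simp

variable (ha : a.Admissible)
include ha

theorem RewardModel.integrable_regret :
    Integrable (fun ω => regret a P (realization R ω) (globalObjective floc)) μ :=
  .of_mem_Icc 0 (a.M * a.T)
    ((measurable_regret P ha _).comp hR.measurable_realization).aemeasurable
    (.of_forall fun _ => ⟨hR.regret_nonneg _, hR.regret_le_mul _⟩)

theorem RewardModel.integral_regret_le_mul :
    ∫ ω, regret a P (realization R ω) (globalObjective floc) ∂μ ≤ a.M * a.T := by
  simpa using integral_mono (hR.integrable_regret (P := P) ha) (integrable_const _)
    fun ω => hR.regret_le_mul (realization R ω)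

variable (hcal : a.Calibrated)
include hcal

theorem RewardModel.integral_regret_le_add_one {G : ℝ} (hG : 0 ≤ G)
    (hacc : ∀ r, Accurate a P (globalObjective floc) r → regret a P r (globalObjective floc) ≤ G) :
    ∫ ω, regret a P (realization R ω) (globalObjective floc) ∂μ ≤ G + 1 := by
  let Y : Ω → ℝ := fun ω => regret a P (realization R ω) (globalObjective floc)
  have hY : Measurable Y := (measurable_regret P ha _).comp hR.measurable_realization
  have hprob : μ.real {ω | G < Y ω} ≤ a.T ^ 2 * failureProb a :=
    (measureReal_mono fun ω hω hgood => (hacc _ hgood).not_gt hω).trans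
      (hR.measureReal_not_accurate_le ha P)
  calc ∫ ω, Y ω ∂μ ≤ G + a.M * a.T * μ.real {ω | G < Y ω} :=
        integral_le_add_mul_measureReal (hR.integrable_regret ha) hG (fun _ => hR.regret_le_mul _)
          (measurableSet_lt measurable_const hY) fun _ hω => not_lt.1 hω
    _ ≤ G + a.M * a.T * (a.T ^ 2 * failureProb a) := by gcongr
    _ = G + a.M * a.T ^ 3 * failureProb a := by ring
    _ ≤ G + 1 := by gcongr; exact hcal.mul_failureProb_le_one

variable {ℓ : X → X → ℝ} {C d : ℝ} (hs : LocalSmoothness P ℓ (globalObjective floc) a.ν₁ a.ρ)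
  (hdim : NearOptimalityDimension P (globalObjective floc) a.ν₁ a.ρ C d)
  (hC : 0 < C) (hd : 0 ≤ d)
include hs hdim hC hd

theorem RewardModel.integral_regret_le_of_pow_le
    (hQ : ∀ h, level a h ≤ a.M →
      (a.k : ℝ) ^ h ≤ (a.M * (a.ν₁ ^ 2 / a.c ^ 2)) ^ (-(1 / (2 * Real.logb a.k a.ρ)))) :
    ∫ ω, regret a P (realization R ω) (globalObjective floc) ∂μ ≤
      constC₁ a.k a.ν₁ a.ρ a.c * (a.M : ℝ) ^ (1 - 1 / (2 * Real.logb a.k a.ρ)) +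
        constC₂ a.k a.ν₁ a.ρ a.c C d * logTerm a ^ (1 / (d + 2)) *
          ((a.M : ℝ) ^ ((d + 1) / (d + 2)) * (a.T : ℝ) ^ ((d + 1) / (d + 2))) := by
  have hρ := ha.ρ_pos
  have hν₁ := ha.ν₁_pos
  have hc := ha.c_pos
  have hlog := ha.logTerm_pos
  have hk : (0 : ℝ) < a.k := by exact_mod_cast ha.k_pos
  have hM : (1 : ℝ) ≤ a.M := by exact_mod_cast ha.one_le_M
  have hρ' := sub_pos.2 ha.ρ_lt_one
  have hC₂ := constC₂_nonneg ha hC.le hd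
  obtain ⟨J, hJ⟩ := exists_depth_tradeoff hρ ha.ρ_lt_one hd
    (show 0 < branchingCost a C by unfold branchingCost; positivity)
    (show 0 < 12 * a.ν₁ by positivity) (one_pos.trans_le hcal.one_le_M_mul_T)
  rw [two_mul_branchingCost_rpow_eq ha hC.le hd,
    Real.mul_rpow a.M.cast_nonneg a.T.cast_nonneg] at hJ
  have hexpect := hR.integral_regret_le_add_one ha hcal (by positivity) fun r hr =>
    (regret_le_of_accurate ha hs hR.le_optimum hr hQ hdim (by positivity) hC.le J).trans
      (add_le_add_right hJ _)
  linarith [add_M_le_constC₁_mul_rpow ha]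

theorem RewardModel.integral_regret_le {Φ : ℝ} (hΦ1 : 1 ≤ Φ)
    (hΦ : 2 ≤ a.M * a.T →
      logTerm a ^ (1 / (d + 2)) ≤ Φ * Real.log (a.M * a.T) ^ (1 / (d + 2))) :
    ∫ ω, regret a P (realization R ω) (globalObjective floc) ∂μ ≤
      constC₁ a.k a.ν₁ a.ρ a.c * (a.M : ℝ) ^ (1 - 1 / (2 * Real.logb a.k a.ρ)) +
        constC₂ a.k a.ν₁ a.ρ a.c C d * Φ * regretRate a.M a.T d := by
  have hC₂ := constC₂_nonneg ha hC.le hd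
  have hrate := regretRate_nonneg a.M a.T d
  have hfirst := M_le_constC₁_mul_rpow ha
  have htrivial := hR.integral_regret_le_mul (P := P) ha
  rcases hcal.one_le_T.eq_or_lt' with hT | hT
  · rw [hT, Nat.cast_one, mul_one] at htrivial
    have hsecond : 0 ≤ constC₂ a.k a.ν₁ a.ρ a.c C d * Φ * regretRate a.M a.T d := by positivity
    linarith
  by_cases hexc : a.M = 1 ∧ a.T = 2 ∧ 1 ≤ a.ν₁
  · obtain ⟨hM, hT, hν₁⟩ := hexc
    have hconst := two_le_constC₂ ha hcal.two_le_c hν₁ (hdim.one_le ha.ν₁_pos.le hs) hd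
    have hhalf : 1 / 2 ≤ regretRate a.M a.T d := by simpa only [hM, hT] using half_le_regretRate hd
    have hsecond : 2 * 1 * (1 / 2) ≤ constC₂ a.k a.ν₁ a.ρ a.c C d * Φ * regretRate a.M a.T d := by
      gcongr
    have hMT : (a.M : ℝ) * a.T = a.M + 1 := by rw [hM, hT]; norm_num
    linarith
  · refine (hR.integral_regret_le_of_pow_le ha hcal hs hdim hC hd fun h =>
      pow_le_of_level_le ha hcal hT fun hM hT =>
        (not_le.1 fun hν₁ => hexc ⟨hM, hT, hν₁⟩).le).trans ?_
    have hroot := hΦ (hT.trans_le (Nat.le_mul_of_pos_left _ ha.one_le_M))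
    calc _ ≤ _ + constC₂ a.k a.ν₁ a.ρ a.c C d * (Φ * Real.log (a.M * a.T) ^ (1 / (d + 2))) *
          ((a.M : ℝ) ^ ((d + 1) / (d + 2)) * (a.T : ℝ) ^ ((d + 1) / (d + 2))) := by gcongr
      _ = _ := by
        unfold regretRate
        ring

end Expectation

/-! ### The logarithmic factor -/

section LogFactor

variable {a : Params} (hcal : a.Calibrated) {d : ℝ} (hd : 0 ≤ d) (hMT : 2 ≤ a.M * a.T)
include hcal hd hMT

theorem Params.Calibrated.logTerm_rpow_le_one_add_log_mul :
    logTerm a ^ (1 / (d + 2)) ≤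
      (1 + Real.log a.c₁) * Real.log (a.M * a.T) ^ (1 / (d + 2)) := by
  have hc₁ := Real.log_pos hcal.one_lt_c₁
  have hlog : 1 / 2 ≤ Real.log (a.M * a.T) :=
    (by linarith [Real.log_two_gt_d9] : 1 / 2 ≤ Real.log 2).trans
      (Real.log_le_log two_pos (by exact_mod_cast hMT))
  refine rpow_one_div_add_two_le_mul hcal.logTerm_pos.le (by linarith) (by linarith) ?_ hd
  calc logTerm a = 2 * Real.log a.c₁ * (1 / 2) + Real.log (a.M * a.T) := by
        rw [hcal.logTerm_eq]
        ring
    _ ≤ 2 * Real.log a.c₁ * Real.log (a.M * a.T) + Real.log (a.M * a.T) := by gcongr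
    _ ≤ (1 + Real.log a.c₁) ^ 2 * Real.log (a.M * a.T) := by
        linarith [mul_nonneg (sq_nonneg (Real.log a.c₁)) (by linarith : 0 ≤ Real.log (a.M * a.T))]

theorem Params.Calibrated.logTerm_rpow_le_five_fourths_mul
    (hc₁ : a.c₁ = (2 * (a.M : ℝ)) ^ (1 / 8 : ℝ)) :
    logTerm a ^ (1 / (d + 2)) ≤ 5 / 4 * Real.log (a.M * a.T) ^ (1 / (d + 2)) := by
  have hM : (1 : ℝ) ≤ a.M := by exact_mod_cast hcal.one_le_M
  have hT : (1 : ℝ) ≤ a.T := by exact_mod_cast hcal.one_le_T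
  have hlog_two : Real.log 2 ≤ Real.log (a.M * a.T) :=
    Real.log_le_log two_pos (by exact_mod_cast hMT)
  have hlog_M : Real.log a.M ≤ Real.log (a.M * a.T) :=
    Real.log_le_log (by linarith) (le_mul_of_one_le_right (by linarith) hT)
  have hlog := Real.log_nonneg hcal.one_le_M_mul_T
  have hlog_c₁ : Real.log a.c₁ = 1 / 8 * (Real.log 2 + Real.log a.M) := by
    rw [hc₁, Real.log_rpow (by linarith), Real.log_mul two_ne_zero (by linarith)]
  refine rpow_one_div_add_two_le_mul hcal.logTerm_pos.le hlog (by norm_num) ?_ hd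
  rw [hcal.logTerm_eq]
  linarith

end LogFactor

end FedPNE

theorem mainTheorem1 {X Ω : Type*} [MeasurableSpace Ω] (μ : Measure Ω) [IsProbabilityMeasure μ]
    (k M T : ℕ) (hk : 2 ≤ k) (hM : 1 ≤ M) (hT : 1 ≤ T)
    (P : FedPNE.HierarchicalPartition X k) (ℓ : X → X → ℝ)
    (floc : Fin M → X → ℝ) (R : Fin M → ℕ → X → Ω → ℝ) (hR : FedPNE.RewardModel μ floc R)
    (ν₁ ρ : ℝ) (hν₁ : 0 < ν₁) (hρ₀ : 0 < ρ) (hρ₁ : ρ < 1)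
    (hsmooth : FedPNE.LocalSmoothness P ℓ (FedPNE.globalObjective floc) ν₁ ρ)
    (C d : ℝ) (hC : 0 < C) (hd : 0 ≤ d)
    (hdim : FedPNE.NearOptimalityDimension P (FedPNE.globalObjective floc) ν₁ ρ C d)
    (c c₁ : ℝ) (hc : 2 ≤ c) (hc₁ : (2 * (M : ℝ)) ^ (1 / 8 : ℝ) ≤ c₁) :
    let a : FedPNE.Params :=
      { k := k, M := M, T := T, ν₁ := ν₁, ρ := ρ, c := c, c₁ := c₁, δ := 1 / (M : ℝ) }
    let Reg : Ω → ℝ := fun ω =>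
      FedPNE.regret a P (fun m t x => R m t x ω) (FedPNE.globalObjective floc)
    Integrable Reg μ ∧
    ∫ ω, Reg ω ∂μ ≤
      FedPNE.constC₁ k ν₁ ρ c * (M : ℝ) ^ (1 - 1 / (2 * Real.logb k ρ))
        + FedPNE.constC₂ k ν₁ ρ c C d * (1 + Real.log c₁) * FedPNE.regretRate M T d ∧
    (c₁ = (2 * (M : ℝ)) ^ (1 / 8 : ℝ) →
      ∫ ω, Reg ω ∂μ ≤
        FedPNE.constC₁ k ν₁ ρ c * (M : ℝ) ^ (1 - 1 / (2 * Real.logb k ρ))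
          + FedPNE.constC₂ k ν₁ ρ c C d * (5 / 4) * FedPNE.regretRate M T d) := by
  intro a Reg
  have hcal : a.Calibrated := ⟨hM, hT, hc, hc₁, rfl⟩
  have ha : a.Admissible := ⟨hk, hM, hν₁, hρ₀, hρ₁, hcal.c_pos, hcal.logTerm_pos⟩
  have hΦ : 1 ≤ 1 + Real.log c₁ := by linarith [Real.log_pos hcal.one_lt_c₁]
  exact ⟨hR.integrable_regret ha,
    hR.integral_regret_le ha hcal hsmooth hdim hC hd hΦ
      (hcal.logTerm_rpow_le_one_add_log_mul hd),
    fun hc₁_eq => hR.integral_regret_le ha hcal hsmooth hdim hC hd (by norm_num)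
      fun hMT => hcal.logTerm_rpow_le_five_fourths_mul hd hMT hc₁_eq⟩
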